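/- Let $k,j\in\mathbb N$ satisfy $2\le j\le k-1$, and let $a$ be the unique integer with $1\le a\le k-j$ and $a\equiv k \pmod{k-j}$. Let $H^k(n,p)$ be the $k$-uniform binomial random hypergraph on $n$ vertices, in which each $k$-set of vertices forms an edge with probability $p$ independently. A $j$-tight path of length $\ell$ consists of distinct vertices $x_1,\dots,x_{j+(k-j)\ell}$ and edges $e_1,\dots,e_\ell$ with $e_i=\{x_{(k-j)(i-1)+1},\dots,x_{(k-j)(i-1)+k}\}$; let $L_P$ denote the length of the longest $j$-tight path in $H^k(n,p)$. Set $$p_0=p_0(n,k,j):=\frac{1}{\binom{k-j}{a}\binom{n}{k-j}}.$$ For every $\delta>0$, every constant $c>1$ and every real sequence $(c_n)_{n\in\mathbb N}$ with $c_n\to c$ the following holds. Let $p=p(n)=c_np_0$ (which lies in $[0,1]$ for all large $n$), and set $$L_1=L_1(p):=\frac{1-c^{-1/(k-j)}}{k-j}\cdot n.$$ Then, with probability tending to $1$ as $n\to\infty$, $$L_P\ \ge\ \Bigl(1-\frac{\delta}{3}\Bigr)L_1(p).$$ -/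

import Mathlib

open MeasureTheory ProbabilityTheory Filter Topology

/-- The `i`-th edge (`i = 0, 1, …`) of a `j`-tight path of length `ℓ` with vertices
`x 0, …, x (j + (k - j) * ℓ - 1)`: the set of the `k` consecutive vertices that starts at position
`(k - j) * i`. -/
def tightPathEdge {V : Type*} {k j ℓ : ℕ} (x : Fin (j + (k - j) * ℓ) ↪ V) (i : ℕ) : Finset V :=
  (Finset.univ.filter fun t : Fin (j + (k - j) * ℓ) =>
    (k - j) * i ≤ (t : ℕ) ∧ (t : ℕ) < (k - j) * i + k).map x

/-- The hypergraph with edge set `H` contains a `j`-tight path of length `ℓ`, for `k`-uniform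
hypergraphs: there are distinct vertices `x 0, …, x (j + (k - j) * ℓ - 1)` such that all the `ℓ`
edges they determine belong to `H`. -/
def HasTightPath {V : Type*} (k j : ℕ) (H : Set (Finset V)) (ℓ : ℕ) : Prop :=
  ∃ x : Fin (j + (k - j) * ℓ) ↪ V, ∀ i < ℓ, tightPathEdge x i ∈ H

/-- For `j < k` and finitely many vertices the length of a `j`-tight path is bounded, so that the
supremum in `longestTightPath` is over a bounded set. -/
theorem bddAbove_hasTightPath {V : Type*} [Finite V] {k j : ℕ} (hjk : j < k)
    (H : Set (Finset V)) : BddAbove {ℓ : ℕ | HasTightPath k j H ℓ} := by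
  refine ⟨Nat.card V, ?_⟩
  rintro ℓ ⟨x, -⟩
  have h := Nat.card_le_card_of_injective x x.injective
  rw [Nat.card_fin] at h
  have h1 : 1 * ℓ ≤ (k - j) * ℓ := Nat.mul_le_mul_right ℓ (by omega)
  omega

/-- The length of a longest `j`-tight path in the hypergraph with edge set `H`
(`0` if there is no such path at all, that is, if there are fewer than `j` vertices). -/
noncomputable def longestTightPath {V : Type*} (k j : ℕ) (H : Set (Finset V)) : ℕ :=
  sSup {ℓ : ℕ | HasTightPath k j H ℓ}

/-- The law of (the edge set of) the `k`-uniform binomial random hypergraph on `n` vertices: each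
`k`-set of vertices is an edge with probability `p`, independently. -/
noncomputable def binomialHypergraph (k n : ℕ) (p : unitInterval) :
    Measure (Set (Finset (Fin n))) :=
  setBernoulli {e : Finset (Fin n) | e.card = k} p

/-- `p₀(n) = 1 / (C(k - j, a) * C(n, k - j))`. -/
noncomputable def tightPathThreshold (k j a n : ℕ) : ℝ :=
  1 / (((k - j).choose a : ℝ) * (n.choose (k - j) : ℝ))

/-- `L₁ = (1 - c ^ (-1 / (k - j))) / (k - j) * n`. -/
noncomputable def tightPathL₁ (k j : ℕ) (c : ℝ) (n : ℕ) : ℝ :=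
  (1 - c ^ (-1 / ((k : ℝ) - (j : ℝ)))) / ((k : ℝ) - (j : ℝ)) * (n : ℝ)

/-!
The proof follows a depth-first search for a long tight path. Write `b = k - j` and `C = b.choose a`,
where `j = a + b * m`. A node of the search is a path, and what matters of it is the `j`-set of its
last vertices. If that `j`-set forms an edge with a set `N` of `b` new vertices, the path can be
extended, and this in `C` ways: one block of `b` vertices may still be reordered so that any `a` of
its vertices come last (`extendList`), which leads to `C` different `j`-sets. A node has about
`(1 - θ) ^ b * n.choose b` possible sets `N` if a proportion `θ` of the vertices is in use, and
`p = cₙ / (C * n.choose b)`, so on average it has about `c * (1 - θ) ^ b` descendants. This is more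
than `1` as long as the path is shorter than `L₁`, and then the search is unlikely to die out.

Two points make this precise.

* *The queries of a node are nearly all new.* An edge may be queried only if it contains the end set
  of no node seen so far except the current one. A node whose end set has at least two vertices
  outside the current end set `T` spoils at most `n ^ (b - 2)` of the sets `N`, and there are `O(n)`
  nodes. Nodes with one vertex outside `T` are few (`SearchState.Valid.card_near_le`): here `j ≥ 2`
  is used, by which such a node has vertices in common with `T`, and the search never appends a
  vertex more than `D` times nor extends a node more than `s` times.

* *Exponential supermartingale.* With `X` edges found in `t` queries, `lam ^ X * β ^ t` with
  `β = 1 / (1 - p * (1 - lam))` has constant expectation along the search. Every node that is dead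
  without having been extended `s` times has cost at least `q` queries, so `t` is large compared with
  `X` whenever the search has died out, or has found `K * n` edges without a path of length `L`
  (`SearchState.Valid.pow_le_potential`). Then the potential is at least `g ^ R`, where `R` is the
  number of nodes at the start, and so failure has probability at most `g ^ (-R)`
  (`SearchState.measure_noPath_mul_le_one`).

The search is not defined as a random process. Instead, `SearchState.Valid` states the
invariants of a state, and `SearchState.Valid.measure_noPath_mul_le` bounds the probability of failure
given the answers recorded in a state, by induction on the states: each state that is not terminal
has a query, which leads to two valid states, or allows giving up its current node. The asymptotic
part chooses `R` and `D` as `√n`, with `s` and `K` constant.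
-/

set_option linter.unusedSectionVars false

/-! ### Tight paths as lists of vertices -/

section PathList

variable {V : Type*} [DecidableEq V]

/-- The set of the last `j` vertices of a list: the `j`-set at which a path is extended. -/
def endSet (j : ℕ) (l : List V) : Finset V := (l.drop (l.length - j)).toFinset

/-- `l` lists the vertices of a `j`-tight path with `ℓ` edges in the `(j + b)`-uniform hypergraph
with edge set `F`. -/
structure IsPathList (j b : ℕ) (F : Finset (Finset V)) (ℓ : ℕ) (l : List V) : Prop where
  nodup : l.Nodup
  length_eq : l.length = j + b * ℓ
  window : ∀ i < ℓ, ((l.drop (b * i)).take (j + b)).toFinset ∈ F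

/-- The vertices before the block that is reordered when `N` is appended to `l`. -/
noncomputable def extPre (j a : ℕ) (l : List V) (N : Finset V) : List V :=
  (l ++ N.toList).take (l.length - j + a)

/-- The block of `b` vertices that is reordered when `N` is appended to `l`: no edge of the path
and not the new edge either begins or ends inside it. -/
noncomputable def extBlock (j b a : ℕ) (l : List V) (N : Finset V) : List V :=
  ((l ++ N.toList).drop (l.length - j + a)).take b

/-- The vertices after the block that is reordered when `N` is appended to `l`. -/
noncomputable def extPost (j b a : ℕ) (l : List V) (N : Finset V) : List V :=
  (l ++ N.toList).drop (l.length - j + a + b)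

/-- The path that arises from `l` by appending the vertices of `N` and reordering one block so that
the vertices of `A` are its last ones. -/
noncomputable def extendList (j b a : ℕ) (l : List V) (N A : Finset V) : List V :=
  extPre j a l N ++ ((extBlock j b a l N).filter (· ∉ A) ++ (extBlock j b a l N).filter (· ∈ A))
    ++ extPost j b a l N

lemma extPre_append (j b a : ℕ) (l : List V) (N : Finset V) :
    extPre j a l N ++ extBlock j b a l N ++ extPost j b a l N = l ++ N.toList := by
  unfold extPre extBlock extPost
  rw [List.append_assoc, ← List.drop_drop (j := l.length - j + a), List.take_append_drop,
    List.take_append_drop]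

lemma filter_not_append_filter_perm (q : List V) (A : Finset V) :
    (q.filter (· ∉ A) ++ q.filter (· ∈ A)).Perm q := by
  refine List.perm_append_comm.trans ?_
  have := List.filter_append_perm (fun x => decide (x ∈ A)) q
  simpa using this

lemma extendList_perm (j b a : ℕ) (l : List V) (N A : Finset V) :
    (extendList j b a l N A).Perm (l ++ N.toList) := by
  rw [← extPre_append j b a l N]
  unfold extendList
  exact ((filter_not_append_filter_perm _ A).append_left _).append_right _

lemma length_extendList (j b a : ℕ) (l : List V) (N A : Finset V) :
    (extendList j b a l N A).length = l.length + N.card := by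
  rw [(extendList_perm j b a l N A).length_eq]; simp

section Extend

variable {j b a m : ℕ} {l : List V} {N A : Finset V}

lemma nodup_append_toList (hl : l.Nodup) (hN : ∀ v ∈ N, v ∉ l) : (l ++ N.toList).Nodup := by
  refine List.Nodup.append hl N.nodup_toList ?_
  intro v hv hv'
  exact hN v (by simpa using hv') hv

lemma nodup_parts (hl : l.Nodup) (hN : ∀ v ∈ N, v ∉ l) :
    (extPre j a l N ++ extBlock j b a l N ++ extPost j b a l N).Nodup := by
  rw [extPre_append]; exact nodup_append_toList hl hN

lemma length_extBlock (hj : j = a + b * m) (hlen : j ≤ l.length) (hb : N.card = b) :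
    (extBlock j b a l N).length = b := by
  unfold extBlock
  have : 0 ≤ b * m := Nat.zero_le _
  simp only [List.length_take, List.length_drop, List.length_append, Finset.length_toList, hb]
  omega

lemma length_extPre (hj : j = a + b * m) (hlen : j ≤ l.length) :
    (extPre j a l N).length = l.length - j + a := by
  unfold extPre
  have : 0 ≤ b * m := Nat.zero_le _
  simp only [List.length_take, List.length_append, Finset.length_toList]
  omega

lemma nodup_extBlock (hl : l.Nodup) (hN : ∀ v ∈ N, v ∉ l) : (extBlock j b a l N).Nodup := by
  have := nodup_parts (j := j) (b := b) (a := a) hl hN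
  exact ((List.nodup_append.1 (List.nodup_append.1 this).1).2.1)

lemma card_extBlock (hj : j = a + b * m) (hlen : j ≤ l.length) (hb : N.card = b)
    (hl : l.Nodup) (hN : ∀ v ∈ N, v ∉ l) : (extBlock j b a l N).toFinset.card = b := by
  rw [List.toFinset_card_of_nodup (nodup_extBlock hl hN), length_extBlock hj hlen hb]

lemma length_filter_mem (q : List V) (hq : q.Nodup) (hA : A ⊆ q.toFinset) :
    (q.filter (· ∈ A)).length = A.card := by
  rw [← List.toFinset_card_of_nodup (hq.filter _)]
  congr 1
  ext v
  simp only [List.mem_toFinset, List.mem_filter, decide_eq_true_eq]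
  exact ⟨fun h => h.2, fun h => ⟨by simpa using hA h, h⟩⟩

lemma endSet_extendList (hj : j = a + b * m) (hlen : j ≤ l.length) (hb : N.card = b)
    (hl : l.Nodup) (hN : ∀ v ∈ N, v ∉ l) (hA : A ⊆ (extBlock j b a l N).toFinset)
    (hAc : A.card = a) :
    endSet j (extendList j b a l N A) = A ∪ (extPost j b a l N).toFinset := by
  have h1 := length_filter_mem _ (nodup_extBlock (j := j) (b := b) (a := a) hl hN) hA
  have h2 := (filter_not_append_filter_perm (extBlock j b a l N) A).length_eq
  rw [List.length_append, length_extBlock hj hlen hb] at h2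
  have h3 := length_extPre (N := N) hj hlen
  have hx : (extendList j b a l N A).length - j =
      (extPre j a l N ++ (extBlock j b a l N).filter (· ∉ A)).length := by
    rw [length_extendList, List.length_append]
    omega
  unfold endSet
  rw [hx]
  have : extendList j b a l N A = (extPre j a l N ++ (extBlock j b a l N).filter (· ∉ A)) ++
      ((extBlock j b a l N).filter (· ∈ A) ++ extPost j b a l N) := by
    simp [extendList]
  rw [this, List.drop_left]
  ext v
  simp only [List.toFinset_append, Finset.mem_union, List.mem_toFinset, List.mem_filter,
    decide_eq_true_eq]
  constructor
  · rintro (h | h)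
    · exact Or.inl h.2
    · exact Or.inr h
  · rintro (h | h)
    · exact Or.inl ⟨by simpa using hA h, h⟩
    · exact Or.inr h

lemma drop_sub_append (hlen : j ≤ l.length) :
    ((l ++ N.toList).drop (l.length - j)).toFinset = endSet j l ∪ N := by
  rw [List.drop_append_of_le_length (by omega)]
  simp [endSet]

lemma extBlock_subset : (extBlock j b a l N).toFinset ⊆
    ((l ++ N.toList).drop (l.length - j)).toFinset := by
  intro v hv
  simp only [List.mem_toFinset] at hv ⊢
  unfold extBlock at hv
  rw [← List.drop_drop] at hv
  exact List.mem_of_mem_drop (List.mem_of_mem_take hv)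

lemma extPost_subset : (extPost j b a l N).toFinset ⊆
    ((l ++ N.toList).drop (l.length - j)).toFinset := by
  intro v hv
  simp only [List.mem_toFinset] at hv ⊢
  unfold extPost at hv
  rw [add_assoc, ← List.drop_drop] at hv
  exact List.mem_of_mem_drop hv

lemma endSet_extendList_subset (hj : j = a + b * m) (hlen : j ≤ l.length) (hb : N.card = b)
    (hl : l.Nodup) (hN : ∀ v ∈ N, v ∉ l) (hA : A ⊆ (extBlock j b a l N).toFinset)
    (hAc : A.card = a) :
    endSet j (extendList j b a l N A) ⊆ endSet j l ∪ N := by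
  rw [endSet_extendList hj hlen hb hl hN hA hAc, ← drop_sub_append hlen]
  exact Finset.union_subset (hA.trans extBlock_subset) extPost_subset

lemma card_endSet (hlen : j ≤ l.length) (hl : l.Nodup) : (endSet j l).card = j := by
  unfold endSet
  rw [List.toFinset_card_of_nodup (hl.sublist (List.drop_sublist _ _))]
  simp; omega

lemma endSet_subset : endSet j l ⊆ l.toFinset := by
  intro v hv
  simp only [endSet, List.mem_toFinset] at hv ⊢
  exact List.mem_of_mem_drop hv

/-- Distinct choices of `A` lead to distinct end sets. -/
lemma endSet_extendList_injOn (hj : j = a + b * m) (hlen : j ≤ l.length) (hb : N.card = b)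
    (hl : l.Nodup) (hN : ∀ v ∈ N, v ∉ l) :
    Set.InjOn (fun A => endSet j (extendList j b a l N A))
      ((extBlock j b a l N).toFinset.powersetCard a : Set (Finset V)) := by
  intro A hA B hB hAB
  rw [Finset.mem_coe, Finset.mem_powersetCard] at hA hB
  dsimp only at hAB
  rw [endSet_extendList hj hlen hb hl hN hA.1 hA.2, endSet_extendList hj hlen hb hl hN hB.1 hB.2]
    at hAB
  have hd : ∀ v ∈ (extBlock j b a l N).toFinset, v ∉ (extPost j b a l N).toFinset := by
    intro v hv hv'
    have := nodup_parts (j := j) (b := b) (a := a) hl hN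
    have := (List.nodup_append.1 this).2.2 v (by simp_all) v (by simpa using hv')
    exact this rfl
  ext v
  constructor
  · intro h
    have : v ∈ B ∪ (extPost j b a l N).toFinset := hAB ▸ Finset.mem_union_left _ h
    exact (Finset.mem_union.1 this).resolve_right (hd v (hA.1 h))
  · intro h
    have : v ∈ A ∪ (extPost j b a l N).toFinset := hAB ▸ Finset.mem_union_left _ h
    exact (Finset.mem_union.1 this).resolve_right (hd v (hB.1 h))

lemma extPost_of_eq (hm : j = a) (hlen : j ≤ l.length) (hb : N.card = b) :
    extPost j b a l N = [] := by
  unfold extPost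
  rw [List.drop_eq_nil_iff]
  simp
  omega

lemma extBlock_of_eq (hm : j = a) (hlen : j ≤ l.length) (hb : N.card = b) :
    extBlock j b a l N = N.toList := by
  unfold extBlock
  have : l.length - j + a = l.length := by omega
  rw [this, List.drop_left, List.take_of_length_le (by simp [hb])]

lemma extPost_of_le (hm : a + b ≤ j) (hlen : j ≤ l.length) :
    extPost j b a l N = l.drop (l.length - j + a + b) ++ N.toList := by
  unfold extPost
  rw [List.drop_append_of_le_length (by omega)]

lemma eq_or_add_le (hj : j = a + b * m) : j = a ∨ a + b ≤ j := by
  rcases Nat.eq_zero_or_pos m with h | h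
  · left; simp [hj, h]
  · right
    have := Nat.le_mul_of_pos_right b h
    omega

/-- The last vertex of an extension is a new one. -/
lemma getLast?_extendList_mem (hj : j = a + b * m) (ha : 1 ≤ a) (hb1 : 1 ≤ b)
    (hlen : j ≤ l.length) (hb : N.card = b) (hA : A ⊆ (extBlock j b a l N).toFinset)
    (hAc : A.card = a) {w : V} (hw : (extendList j b a l N A).getLast? = some w) : w ∈ N := by
  rcases eq_or_add_le hj with h | h
  · unfold extendList at hw
    rw [extPost_of_eq h hlen hb, List.append_nil, ← List.append_assoc] at hw
    have hne : (extBlock j b a l N).filter (· ∈ A) ≠ [] := by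
      obtain ⟨v, hv⟩ : A.Nonempty := Finset.card_pos.1 (by omega)
      refine List.ne_nil_of_mem (a := v) ?_
      simpa [hv] using hA hv
    rw [List.getLast?_append_of_ne_nil _ hne] at hw
    have := List.mem_of_getLast? hw
    have := (List.mem_filter.1 this).1
    rw [extBlock_of_eq h hlen hb] at this
    simpa using this
  · have hne : N.toList ≠ [] := by
      obtain ⟨v, hv⟩ : N.Nonempty := Finset.card_pos.1 (by omega)
      exact List.ne_nil_of_mem (a := v) (by simpa using hv)
    unfold extendList at hw
    rw [extPost_of_le h hlen, ← List.append_assoc, List.getLast?_append_of_ne_nil _ hne] at hw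
    simpa using List.mem_of_getLast? hw

/-- The end set of an extension contains a new vertex. -/
lemma exists_mem_endSet_extendList (hj : j = a + b * m) (ha : 1 ≤ a) (hb1 : 1 ≤ b)
    (hlen : j ≤ l.length) (hb : N.card = b)
    (hl : l.Nodup) (hN : ∀ v ∈ N, v ∉ l) (hA : A ⊆ (extBlock j b a l N).toFinset)
    (hAc : A.card = a) : ∃ v ∈ endSet j (extendList j b a l N A), v ∈ N := by
  rw [endSet_extendList hj hlen hb hl hN hA hAc]
  rcases eq_or_add_le hj with h | h
  · rw [extBlock_of_eq h hlen hb] at hA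
    obtain ⟨v, hv⟩ : A.Nonempty := Finset.card_pos.1 (by omega)
    exact ⟨v, by simp [hv], by simpa using hA hv⟩
  · obtain ⟨v, hv⟩ : N.Nonempty := Finset.card_pos.1 (by omega)
    exact ⟨v, by simp [extPost_of_le h hlen, hv], hv⟩

/-- If the end set of an extension has at most one vertex outside `S`, then `S` contains one of the
new vertices, or the vertex after which they were appended. The second case can occur only if
`b = 1`. -/
lemma mem_or_getLast?_mem_of_card_sdiff_le (hj : j = a + b * m) (hj2 : 2 ≤ j) (ha : 1 ≤ a)
    (hab : a ≤ b) (hlen : j ≤ l.length) (hb : N.card = b)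
    (hl : l.Nodup) (hN : ∀ v ∈ N, v ∉ l) (hA : A ⊆ (extBlock j b a l N).toFinset)
    (hAc : A.card = a) {S : Finset V}
    (hS : (endSet j (extendList j b a l N A) \ S).card ≤ 1) :
    (∃ v ∈ N, v ∈ S) ∨ ∃ w ∈ S, l.getLast? = some w := by
  by_contra! hcon
  obtain ⟨h1, h2⟩ := hcon
  rw [endSet_extendList hj hlen hb hl hN hA hAc] at hS
  rcases eq_or_add_le hj with h | h
  · rw [extBlock_of_eq h hlen hb] at hA
    have : A ⊆ (A ∪ (extPost j b a l N).toFinset) \ S := by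
      intro v hv
      simp only [Finset.mem_sdiff, Finset.mem_union]
      exact ⟨Or.inl hv, h1 v (by simpa using hA hv)⟩
    have := Finset.card_le_card this
    omega
  · have h3 : N ⊆ (A ∪ (extPost j b a l N).toFinset) \ S := by
      intro v hv
      simp only [Finset.mem_sdiff, Finset.mem_union]
      exact ⟨Or.inr (by simp [extPost_of_le h hlen, hv]), h1 v hv⟩
    have h4 := Finset.card_le_card h3
    have hb1 : b = 1 := by omega
    have ha1 : a = 1 := by omega
    have hne : l ≠ [] := by
      intro h0; rw [h0] at hlen; simp at hlen; omega
    have hlast : l.getLast? = some (l.getLast hne) := List.getLast?_eq_some_getLast hne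
    have hmem : l.getLast hne ∈ A ∪ (extPost j b a l N).toFinset := by
      have hAeq : A = (extBlock j b a l N).toFinset := by
        refine Finset.eq_of_subset_of_card_le hA ?_
        rw [card_extBlock hj hlen hb hl hN]; omega
      have hd : extBlock j b a l N ++ extPost j b a l N =
          (l ++ N.toList).drop (l.length - j + a) := by
        unfold extBlock extPost
        rw [← List.drop_drop (j := l.length - j + a), List.take_append_drop]
      rw [hAeq, ← List.toFinset_append, hd, List.drop_append_of_le_length (by omega)]
      simp only [List.toFinset_append, Finset.mem_union, List.mem_toFinset]
      left
      have hx : l.drop (l.length - j + a) ≠ [] := by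
        rw [Ne, List.drop_eq_nil_iff]; omega
      have := List.getLast_mem hx
      rwa [List.getLast_drop] at this
    have hnS : l.getLast hne ∉ S := fun hs => h2 _ hs hlast
    have hnN : l.getLast hne ∉ N := fun hs => hN _ hs (List.getLast_mem hne)
    have h5 : insert (l.getLast hne) N ⊆ (A ∪ (extPost j b a l N).toFinset) \ S := by
      refine Finset.insert_subset ?_ h3
      simp only [Finset.mem_sdiff]
      exact ⟨hmem, hnS⟩
    have h6 := Finset.card_le_card h5
    rw [Finset.card_insert_of_notMem hnN] at h6
    omega

lemma toFinset_take_drop_congr {p q q' r : List V} (hq : q.Perm q') {s t : ℕ} (hs : s ≤ p.length)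
    (ht : s + t ≤ p.length ∨ p.length + q.length ≤ s + t) :
    (((p ++ q ++ r).drop s).take t).toFinset = (((p ++ q' ++ r).drop s).take t).toFinset := by
  have hlen := hq.length_eq
  rw [List.append_assoc, List.append_assoc, List.drop_append_of_le_length hs,
    List.drop_append_of_le_length hs]
  rcases ht with ht | ht
  · rw [List.take_append_of_le_length (by simp; omega),
      List.take_append_of_le_length (by simp; omega)]
  · rw [← List.append_assoc, ← List.append_assoc,
      List.take_append (l₁ := _ ++ q), List.take_append (l₁ := _ ++ q'),
      List.take_of_length_le (l := _ ++ q) (by simp; omega),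
      List.take_of_length_le (l := _ ++ q') (by simp; omega)]
    ext v
    simp [hq.mem_iff, hlen]

/-- Appending `N` adds the edge formed by the end set and `N`, and the reordering does not change
the other edges, since none of them begins or ends inside the reordered block. -/
lemma IsPathList.extend {F : Finset (Finset V)} {ℓ : ℕ} (hP : IsPathList j b F ℓ l)
    (hj : j = a + b * m) (hb : N.card = b) (hN : ∀ v ∈ N, v ∉ l) :
    IsPathList j b (insert (endSet j l ∪ N) F) (ℓ + 1) (extendList j b a l N A) := by
  have hlen : j ≤ l.length := by rw [hP.length_eq]; omega
  have hl := hP.length_eq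
  refine ⟨?_, ?_, ?_⟩
  · exact (extendList_perm j b a l N A).nodup_iff.2 (nodup_append_toList hP.nodup hN)
  · rw [length_extendList, hP.length_eq, hb]; ring
  · intro i hi
    have key : (((extendList j b a l N A).drop (b * i)).take (j + b)).toFinset =
        (((l ++ N.toList).drop (b * i)).take (j + b)).toFinset := by
      rw [← extPre_append j b a l N]
      unfold extendList
      have hi' : b * i ≤ b * ℓ := Nat.mul_le_mul_left _ (by omega)
      refine toFinset_take_drop_congr (filter_not_append_filter_perm _ _) ?_ ?_
      · rw [length_extPre hj hlen]; omega
      · rw [length_extPre hj hlen, (filter_not_append_filter_perm _ _).length_eq,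
          length_extBlock hj hlen hb, hl]
        rcases Nat.lt_or_ge ℓ (i + m + 1) with h | h
        · right
          have : b * ℓ ≤ b * (i + m) := Nat.mul_le_mul_left _ (by omega)
          rw [mul_add] at this
          omega
        · left
          have : b * (i + m + 1) ≤ b * ℓ := Nat.mul_le_mul_left _ h
          rw [mul_add, mul_add] at this
          omega
    rw [key]
    rcases Nat.lt_succ_iff_lt_or_eq.1 hi with h | h
    · have h1 : b * (i + 1) ≤ b * ℓ := Nat.mul_le_mul_left _ h
      rw [mul_add] at h1
      rw [List.drop_append_of_le_length (by omega),
        List.take_append_of_le_length (by simp; omega)]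
      exact Finset.mem_insert_of_mem (hP.window i h)
    · subst h
      have : b * i = l.length - j := by omega
      rw [this, List.take_of_length_le (by simp [hb]; omega), drop_sub_append hlen]
      exact Finset.mem_insert_self _ _

end Extend

lemma IsPathList.mono {j b ℓ : ℕ} {F F' : Finset (Finset V)} {l : List V}
    (h : IsPathList j b F ℓ l) (hF : F ⊆ F') : IsPathList j b F' ℓ l :=
  ⟨h.nodup, h.length_eq, fun i hi => hF (h.window i hi)⟩

/-- The list of vertices of a path gives a tight path in the sense of `HasTightPath`. -/
lemma IsPathList.hasTightPath {j b ℓ : ℕ} {F : Finset (Finset V)} {l : List V}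
    (h : IsPathList j b F ℓ l) {H : Set (Finset V)} (hF : (F : Set (Finset V)) ⊆ H) :
    HasTightPath (j + b) j H ℓ := by
  have e : j + b - j = b := by omega
  have hl : l.length = j + (j + b - j) * ℓ := by rw [h.length_eq, e]
  refine ⟨⟨fun t => l.get (t.cast hl.symm), ?_⟩, ?_⟩
  · intro s t hst
    have := h.nodup.injective_get hst
    simpa using this
  · intro i hi
    have hmem := hF (h.window i hi)
    convert hmem
    ext v
    simp only [tightPathEdge, Finset.mem_map, Finset.mem_filter, Finset.mem_univ, true_and,
      List.mem_toFinset, Function.Embedding.coeFn_mk, List.get_eq_getElem, Fin.val_cast]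
    rw [List.mem_take_iff_getElem]
    simp only [List.getElem_drop, List.length_drop]
    constructor
    · rintro ⟨t, ⟨h1, h2⟩, rfl⟩
      have ht := t.2
      simp only [e] at h1 h2 ht
      have hlen := h.length_eq
      refine ⟨t - b * i, by omega, ?_⟩
      congr 1
      omega
    · rintro ⟨s, hs, rfl⟩
      refine ⟨⟨b * i + s, by omega⟩, ⟨?_, ?_⟩, rfl⟩
      · simp [e]
      · simp only [e]; omega

end PathList

/-! ### States of the search -/

section State

variable {V : Type*} [DecidableEq V]

/-- A state of the depth-first search. A node is a list of vertices of a tight path, which stands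
for the `j`-set of its last `j` vertices. A query is a pair `(x, N)` of a node `x` and a set `N` of
`b` new vertices: it asks whether the last `j` vertices of `x` form an edge with `N`. -/
structure SearchState (V : Type*) where
  /-- the nodes that still may be extended, the current one first -/
  stack : List (List V)
  /-- the nodes that were given up since no admissible query was left -/
  full : List (List V)
  /-- the nodes that were given up since they had been extended often enough -/
  capped : List (List V)
  /-- the queries with a positive answer -/
  found : Finset (List V × Finset V)
  /-- all the queries that were made -/
  queried : Finset (List V × Finset V)

namespace SearchState

/-- All the nodes that were ever on the stack. -/
def seen (S : SearchState V) : List (List V) := S.stack ++ S.full ++ S.capped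

end SearchState

/-- The `(j + b)`-set that a query is about. -/
def queryEdge (j : ℕ) (q : List V × Finset V) : Finset V := endSet j q.1 ∪ q.2

/-- The nodes to which a query with a positive answer leads. -/
noncomputable def children (j b a : ℕ) (q : List V × Finset V) : List (List V) :=
  ((extBlock j b a q.1 q.2).toFinset.powersetCard a).toList.map (extendList j b a q.1 q.2)

/-- Every node `x` of the stack has at most `R + C * ℓ` nodes from itself down to the bottom, where
`ℓ` is the length of the path `x` (so that `x` has `j + b * ℓ` vertices). -/
def StackBound (j b C R : ℕ) : List (List V) → Prop
  | [] => True
  | x :: rest => b * (rest.length + 1) + C * j ≤ b * R + C * x.length ∧ StackBound j b C R rest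

lemma StackBound.append {j b C R : ℕ} {st : List (List V)} (h : StackBound j b C R st)
    (ch : List (List V))
    (hch : ∀ y ∈ ch, b * (ch.length + st.length) + C * j ≤ b * R + C * y.length) :
    StackBound j b C R (ch ++ st) := by
  induction ch with
  | nil => exact h
  | cons y ch ih =>
    simp only [List.length_cons] at hch
    refine ⟨?_, ih fun z hz => ?_⟩
    · have := hch y (by simp)
      change b * ((ch ++ st).length + 1) + C * j ≤ _
      rw [List.length_append]
      convert this using 3
      ring
    · refine le_trans ?_ (hch z (by simp [hz]))
      gcongr
      omega

/-- The parameters of the search: a node is given up after `s` extensions, or, if it has no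
admissible query left, after at least `q` queries; no vertex is appended more than `D` times. -/
structure SearchParams where
  /-- the number of vertices that consecutive edges share -/
  j : ℕ
  /-- the number of vertices that each edge adds -/
  b : ℕ
  /-- the number of vertices of a block that may be kept freely -/
  a : ℕ
  /-- the number of extensions after which a node is given up -/
  s : ℕ
  /-- the number of times a vertex may be appended -/
  D : ℕ
  /-- the number of queries that a node without admissible queries has made -/
  q : ℕ

/-- The invariants of the search that starts with the stack `roots`. -/
structure SearchState.Valid (P : SearchParams) (roots : Finset (List V)) (S : SearchState V) :
    Prop where
  found_subset : S.found ⊆ S.queried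
  queried_spec : ∀ p ∈ S.queried, p.1 ∈ S.seen ∧ p.2.card = P.b ∧ ∀ v ∈ p.2, v ∉ p.1
  edge_inj : Set.InjOn (queryEdge P.j) (S.queried : Set (List V × Finset V))
  seen_nodup : (S.seen.map (endSet P.j)).Nodup
  path : ∀ y ∈ S.seen, ∃ ℓ, IsPathList P.j P.b (S.found.image (queryEdge P.j)) ℓ y
  count : S.seen.length = P.b.choose P.a * S.found.card + roots.card
  bound : StackBound P.j P.b (P.b.choose P.a) roots.card S.stack
  full_card : ∀ y ∈ S.full, P.q ≤ (S.queried.filter (·.1 = y)).card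
  capped_card : ∀ y ∈ S.capped, P.s ≤ (S.found.filter (·.1 = y)).card
  node_card : ∀ y, (S.found.filter (·.1 = y)).card ≤ P.s
  vertex_card : ∀ w, (S.found.filter (w ∈ ·.2)).card ≤ P.D
  parent : ∀ y ∈ S.seen, y ∈ roots ∨ ∃ p ∈ S.found, y ∈ children P.j P.b P.a p

/-- The conditions on parameters under which the search makes sense; `j = a + b * m` with
`1 ≤ a ≤ b` says that `a` is the residue of `j` modulo `b`, where the residue `0` is replaced
by `b`. -/
structure SearchParams.Good (P : SearchParams) : Prop where
  two_le_j : 2 ≤ P.j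
  one_le_a : 1 ≤ P.a
  a_le_b : P.a ≤ P.b
  exists_eq : ∃ m, P.j = P.a + P.b * m

/-- The query `(x, N)` is admissible. -/
structure SearchState.Admissible (P : SearchParams) (S : SearchState V) (x : List V)
    (N : Finset V) : Prop where
  card_eq : N.card = P.b
  notMem : ∀ v ∈ N, v ∉ x
  vertex_lt : ∀ w ∈ N, (S.found.filter (w ∈ ·.2)).card < P.D
  notMem_queried : (x, N) ∉ S.queried
  not_subset : ∀ y ∈ S.seen, endSet P.j y ≠ endSet P.j x → ¬ endSet P.j y ⊆ endSet P.j x ∪ N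

namespace SearchState

variable {P : SearchParams} {roots : Finset (List V)} {S : SearchState V}

lemma Valid.length_le (h : S.Valid P roots) {y : List V} (hy : y ∈ S.seen) : P.j ≤ y.length := by
  obtain ⟨ℓ, hl⟩ := h.path y hy
  rw [hl.length_eq]; omega

lemma Valid.nodup (h : S.Valid P roots) {y : List V} (hy : y ∈ S.seen) : y.Nodup := by
  obtain ⟨ℓ, hl⟩ := h.path y hy
  exact hl.nodup

lemma Valid.eq_of_endSet_eq (h : S.Valid P roots) {x y : List V} (hx : x ∈ S.seen)
    (hy : y ∈ S.seen) (hxy : endSet P.j x = endSet P.j y) : x = y :=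
  List.inj_on_of_nodup_map h.seen_nodup hx hy hxy

lemma mem_seen_of_mem_stack {x : List V} (h : x ∈ S.stack) : x ∈ S.seen := by
  simp [seen, h]

lemma eq_of_endSet_union_eq {x : List V} {N N' : Finset V} (hN : ∀ v ∈ N, v ∉ x) (hN' : ∀ v ∈ N', v ∉ x)
    {j : ℕ} (h : endSet j x ∪ N = endSet j x ∪ N') : N = N' := by
  have key : ∀ M : Finset V, (∀ v ∈ M, v ∉ x) → (endSet j x ∪ M) \ endSet j x = M := by
    intro M hM
    rw [Finset.union_sdiff_left]
    refine Finset.sdiff_eq_self_of_disjoint ?_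
    rw [Finset.disjoint_left]
    intro v hv hv'
    exact hM v hv (by simpa using endSet_subset hv')
  rw [← key N hN, h, key N' hN']

/-- An admissible query asks about a new edge. -/
lemma Valid.queryEdge_notMem (h : S.Valid P roots) {x : List V} (hx : x ∈ S.seen) {N : Finset V}
    (hN : S.Admissible P x N) : queryEdge P.j (x, N) ∉ S.queried.image (queryEdge P.j) := by
  intro hmem
  obtain ⟨⟨y, M⟩, hq, he⟩ := Finset.mem_image.1 hmem
  obtain ⟨hy, -, hM⟩ := h.queried_spec _ hq
  simp only [queryEdge] at he hy hM
  by_cases hxy : endSet P.j y = endSet P.j x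
  · have := h.eq_of_endSet_eq hy hx hxy
    subst this
    have := eq_of_endSet_union_eq hM hN.notMem he
    subst this
    exact hN.notMem_queried hq
  · exact hN.not_subset y hy hxy (he ▸ Finset.subset_union_left)

lemma perm_seen_full {x : List V} {rest full capped : List (List V)} :
    (rest ++ (x :: full) ++ capped).Perm (x :: rest ++ full ++ capped) := by
  simp only [List.append_assoc, List.cons_append]
  exact List.perm_middle

lemma perm_seen_capped {x : List V} {rest full capped : List (List V)} :
    (rest ++ full ++ (x :: capped)).Perm (x :: rest ++ full ++ capped) := by
  simp only [List.cons_append]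
  exact List.perm_middle

/-- The current node is given up because it has made many queries. -/
lemma Valid.pop_full (h : S.Valid P roots) {x : List V} {rest : List (List V)}
    (hst : S.stack = x :: rest) (hq : P.q ≤ (S.queried.filter (·.1 = x)).card) :
    Valid P roots ⟨rest, x :: S.full, S.capped, S.found, S.queried⟩ := by
  have hp : (SearchState.seen ⟨rest, x :: S.full, S.capped, S.found, S.queried⟩).Perm S.seen := by
    simp only [seen, hst]
    exact perm_seen_full
  refine ⟨h.found_subset, ?_, h.edge_inj, ?_, ?_, ?_, ?_, ?_, h.capped_card, h.node_card,
    h.vertex_card, ?_⟩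
  · intro p hp'
    obtain ⟨h1, h2⟩ := h.queried_spec p hp'
    exact ⟨hp.mem_iff.2 h1, h2⟩
  · exact (hp.map _).nodup_iff.2 h.seen_nodup
  · intro y hy; exact h.path y (hp.mem_iff.1 hy)
  · rw [hp.length_eq]; exact h.count
  · have := h.bound
    rw [hst] at this
    exact this.2
  · intro y hy
    rcases List.mem_cons.1 hy with rfl | hy
    · exact hq
    · exact h.full_card y hy
  · intro y hy; exact h.parent y (hp.mem_iff.1 hy)

/-- The current node is given up because it has been extended often. -/
lemma Valid.pop_capped (h : S.Valid P roots) {x : List V} {rest : List (List V)}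
    (hst : S.stack = x :: rest) (hs : P.s ≤ (S.found.filter (·.1 = x)).card) :
    Valid P roots ⟨rest, S.full, x :: S.capped, S.found, S.queried⟩ := by
  have hp : (SearchState.seen ⟨rest, S.full, x :: S.capped, S.found, S.queried⟩).Perm S.seen := by
    simp only [seen, hst]
    exact perm_seen_capped
  refine ⟨h.found_subset, ?_, h.edge_inj, ?_, ?_, ?_, ?_, h.full_card, ?_, h.node_card,
    h.vertex_card, ?_⟩
  · intro p hp'
    obtain ⟨h1, h2⟩ := h.queried_spec p hp'
    exact ⟨hp.mem_iff.2 h1, h2⟩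
  · exact (hp.map _).nodup_iff.2 h.seen_nodup
  · intro y hy; exact h.path y (hp.mem_iff.1 hy)
  · rw [hp.length_eq]; exact h.count
  · have := h.bound
    rw [hst] at this
    exact this.2
  · intro y hy
    rcases List.mem_cons.1 hy with rfl | hy
    · exact hs
    · exact h.capped_card y hy
  · intro y hy; exact h.parent y (hp.mem_iff.1 hy)

lemma Valid.edge_inj_insert (h : S.Valid P roots) {x : List V} (hx : x ∈ S.seen) {N : Finset V}
    (hN : S.Admissible P x N) :
    Set.InjOn (queryEdge P.j) ((insert (x, N) S.queried : Finset (List V × Finset V)) : Set (List V × Finset V)) := by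
  rw [Finset.coe_insert, Set.injOn_insert (by simpa using hN.notMem_queried)]
  refine ⟨h.edge_inj, ?_⟩
  have := h.queryEdge_notMem hx hN
  rw [← Finset.mem_coe, Finset.coe_image] at this
  exact this

lemma Valid.query_no (h : S.Valid P roots) {x : List V} (hx : x ∈ S.seen) {N : Finset V}
    (hN : S.Admissible P x N) :
    Valid P roots ⟨S.stack, S.full, S.capped, S.found, insert (x, N) S.queried⟩ := by
  refine ⟨h.found_subset.trans (Finset.subset_insert _ _), ?_, h.edge_inj_insert hx hN,
    h.seen_nodup, h.path, h.count, h.bound, ?_, h.capped_card, h.node_card, h.vertex_card,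
    h.parent⟩
  · intro p hp
    rcases Finset.mem_insert.1 hp with rfl | hp
    · exact ⟨hx, hN.card_eq, hN.notMem⟩
    · exact h.queried_spec p hp
  · intro y hy
    exact (h.full_card y hy).trans
      (Finset.card_le_card (Finset.filter_subset_filter _ (Finset.subset_insert _ _)))

lemma mem_children {j b a : ℕ} {q : List V × Finset V} {y : List V} :
    y ∈ children j b a q ↔ ∃ A ⊆ (extBlock j b a q.1 q.2).toFinset, A.card = a ∧
      extendList j b a q.1 q.2 A = y := by
  simp [children, Finset.mem_powersetCard, and_assoc]

lemma length_children {j b a m : ℕ} (hj : j = a + b * m) {x : List V} {N : Finset V}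
    (hlen : j ≤ x.length) (hb : N.card = b) (hl : x.Nodup) (hN : ∀ v ∈ N, v ∉ x) :
    (children j b a (x, N)).length = b.choose a := by
  simp only [children, List.length_map, Finset.length_toList, Finset.card_powersetCard]
  rw [card_extBlock hj hlen hb hl hN]

/-- After a positive answer the children are pushed on the stack. Their end sets are new: they lie
in the new edge, which contains no end set seen so far but that of `x`, and they meet `N`, which the
end set of `x` does not. -/
lemma Valid.query_yes (h : S.Valid P roots) (hP : P.Good) {x : List V} {rest : List (List V)}
    (hst : S.stack = x :: rest) {N : Finset V}
    (hN : S.Admissible P x N) (hs : (S.found.filter (·.1 = x)).card < P.s) :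
    Valid P roots ⟨children P.j P.b P.a (x, N) ++ S.stack, S.full, S.capped,
      insert (x, N) S.found, insert (x, N) S.queried⟩ := by
  obtain ⟨m, hj⟩ := hP.exists_eq
  have ha := hP.one_le_a
  have hb1 : 1 ≤ P.b := ha.trans hP.a_le_b
  have hx : x ∈ S.seen := mem_seen_of_mem_stack (by simp [hst])
  have hlen := h.length_le hx
  have hl := h.nodup hx
  have hseen : SearchState.seen ⟨children P.j P.b P.a (x, N) ++ S.stack, S.full, S.capped,
      insert (x, N) S.found, insert (x, N) S.queried⟩ =
      children P.j P.b P.a (x, N) ++ S.seen := by simp [seen]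
  have hnf : (x, N) ∉ S.found := fun hf => hN.notMem_queried (h.found_subset hf)
  refine ⟨Finset.insert_subset_insert _ h.found_subset, ?_, h.edge_inj_insert hx hN, ?_, ?_, ?_,
    ?_, ?_, ?_, ?_, ?_, ?_⟩
  · intro p hp
    rw [hseen]
    rcases Finset.mem_insert.1 hp with rfl | hp
    · exact ⟨List.mem_append_right _ hx, hN.card_eq, hN.notMem⟩
    · obtain ⟨h1, h2⟩ := h.queried_spec p hp
      exact ⟨List.mem_append_right _ h1, h2⟩
  · rw [hseen, List.map_append]
    refine List.Nodup.append ?_ h.seen_nodup ?_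
    · simp only [children, List.map_map]
      refine List.Nodup.map_on ?_ (Finset.nodup_toList _)
      intro A hA B hB hAB
      exact endSet_extendList_injOn hj hlen hN.card_eq hl hN.notMem
        (by simpa using hA) (by simpa using hB) hAB
    · intro J hJ hJ'
      obtain ⟨y, hy, rfl⟩ := List.mem_map.1 hJ
      obtain ⟨z, hz, hzy⟩ := List.mem_map.1 hJ'
      obtain ⟨A, hA, hAc, rfl⟩ := mem_children.1 hy
      have hsub := endSet_extendList_subset hj hlen hN.card_eq hl hN.notMem hA hAc
      obtain ⟨v, hv, hvN⟩ :=
        exists_mem_endSet_extendList hj ha hb1 hlen hN.card_eq hl hN.notMem hA hAc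
      dsimp only at hzy
      by_cases hzx : endSet P.j z = endSet P.j x
      · rw [← hzy, hzx] at hv
        exact hN.notMem v hvN (by simpa using endSet_subset hv)
      · exact hN.not_subset z hz hzx (hzy ▸ hsub)
  · intro y hy
    rw [hseen] at hy
    simp only [Finset.image_insert]
    rcases List.mem_append.1 hy with hy | hy
    · obtain ⟨A, hA, hAc, rfl⟩ := mem_children.1 hy
      obtain ⟨ℓ, hℓ⟩ := h.path x hx
      exact ⟨ℓ + 1, hℓ.extend hj hN.card_eq hN.notMem⟩
    · obtain ⟨ℓ, hℓ⟩ := h.path y hy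
      exact ⟨ℓ, hℓ.mono (Finset.subset_insert _ _)⟩
  · rw [hseen, List.length_append, length_children hj hlen hN.card_eq hl hN.notMem, h.count,
      Finset.card_insert_of_notMem hnf]
    ring
  · refine h.bound.append _ ?_
    intro y hy
    rw [length_children hj hlen hN.card_eq hl hN.notMem]
    obtain ⟨A, hA, hAc, rfl⟩ := mem_children.1 hy
    have := h.bound
    rw [hst] at this
    have := this.1
    rw [hst]
    simp only [length_extendList, hN.card_eq, List.length_cons]
    nlinarith
  · intro y hy
    exact (h.full_card y hy).trans
      (Finset.card_le_card (Finset.filter_subset_filter _ (Finset.subset_insert _ _)))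
  · intro y hy
    exact (h.capped_card y hy).trans
      (Finset.card_le_card (Finset.filter_subset_filter _ (Finset.subset_insert _ _)))
  · intro y
    rw [Finset.filter_insert]
    split_ifs with hy
    · simp only at hy
      subst hy
      exact (Finset.card_insert_le _ _).trans hs
    · exact h.node_card y
  · intro w
    rw [Finset.filter_insert]
    split_ifs with hw
    · exact (Finset.card_insert_le _ _).trans (hN.vertex_lt w hw)
    · exact h.vertex_card w
  · intro y hy
    rw [hseen] at hy
    rcases List.mem_append.1 hy with hy | hy
    · exact Or.inr ⟨_, Finset.mem_insert_self _ _, hy⟩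
    · rcases h.parent y hy with h1 | ⟨p, hp, hp'⟩
      · exact Or.inl h1
      · exact Or.inr ⟨p, Finset.mem_insert_of_mem hp, hp'⟩

/-- The initial state of the search. -/
noncomputable def init (roots : Finset (List V)) : SearchState V := ⟨roots.toList, [], [], ∅, ∅⟩

lemma stackBound_of_length_eq {j b C R : ℕ} : ∀ {st : List (List V)},
    (∀ y ∈ st, y.length = j) → st.length ≤ R → StackBound j b C R st
  | [], _, _ => trivial
  | x :: rest, h, hR => by
    refine ⟨?_, stackBound_of_length_eq (fun y hy => h y (by simp [hy])) (by simp at hR; omega)⟩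
    rw [h x (by simp)]
    have : b * (rest.length + 1) ≤ b * R := Nat.mul_le_mul_left _ (by simpa using hR)
    omega

lemma valid_init (hlen : ∀ y ∈ roots, y.length = P.j) (hnd : ∀ y ∈ roots, y.Nodup)
    (hinj : Set.InjOn (endSet P.j) (roots : Set (List V))) : (init roots).Valid P roots := by
  have hseen : (init roots).seen = roots.toList := by simp [init, seen]
  refine ⟨by simp [init], by simp [init], by simp [init], ?_, ?_, ?_, ?_, by simp [init],
    by simp [init], by simp [init], by simp [init], ?_⟩
  · rw [hseen]
    refine List.Nodup.map_on ?_ (Finset.nodup_toList _)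
    intro A hA B hB hAB
    exact hinj (by simpa using hA) (by simpa using hB) hAB
  · intro y hy
    rw [hseen, Finset.mem_toList] at hy
    exact ⟨0, hnd y hy, by simp [hlen y hy], by simp⟩
  · rw [hseen]; simp [init]
  · exact stackBound_of_length_eq (fun y hy => hlen y (by simpa [init] using hy))
      (by simp [init])
  · intro y hy
    rw [hseen, Finset.mem_toList] at hy
    exact Or.inl hy

lemma card_mul_le_of_fiber {l : List (List V)} (hl : l.Nodup) (Q : Finset (List V × Finset V))
    {c : ℕ} (h : ∀ y ∈ l, c ≤ (Q.filter (·.1 = y)).card) : c * l.length ≤ Q.card := by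
  rw [← List.toFinset_card_of_nodup hl, mul_comm]
  calc l.toFinset.card * c = ∑ y ∈ l.toFinset, c := by simp
    _ ≤ ∑ y ∈ l.toFinset, (Q.filter (·.1 = y)).card :=
        Finset.sum_le_sum fun y hy => h y (by simpa using hy)
    _ = (l.toFinset.biUnion fun y => Q.filter (·.1 = y)).card := by
        rw [Finset.card_biUnion]
        intro y _ z _ hyz
        rw [Function.onFun, Finset.disjoint_filter]
        rintro p - rfl
        exact hyz
    _ ≤ Q.card := Finset.card_le_card (Finset.biUnion_subset.2 fun y _ => Finset.filter_subset _ _)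

lemma Valid.nodup_seen (h : S.Valid P roots) : S.seen.Nodup := h.seen_nodup.of_map _

lemma Valid.mul_full_le (h : S.Valid P roots) : P.q * S.full.length ≤ S.queried.card := by
  refine card_mul_le_of_fiber ?_ _ h.full_card
  have := h.nodup_seen
  unfold seen at this
  exact (List.nodup_append.1 (List.nodup_append.1 this).1).2.1

lemma Valid.mul_capped_le (h : S.Valid P roots) : P.s * S.capped.length ≤ S.found.card := by
  refine card_mul_le_of_fiber ?_ _ h.capped_card
  have := h.nodup_seen
  unfold seen at this
  exact (List.nodup_append.1 this).2.1

end SearchState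

end State

/-! ### Counting spoiled sets -/

section Spoiled

variable {V : Type*} [DecidableEq V]

namespace SearchState

variable {P : SearchParams} {roots : Finset (List V)} {S : SearchState V}

lemma Valid.card_children_le (h : S.Valid P roots) (hP : P.Good) {p : List V × Finset V}
    (hp : p ∈ S.found) : (children P.j P.b P.a p).toFinset.card ≤ P.b.choose P.a := by
  obtain ⟨m, hj⟩ := hP.exists_eq
  obtain ⟨h1, h2, h3⟩ := h.queried_spec p (h.found_subset hp)
  refine (List.toFinset_card_le _).trans ?_
  rw [show p = (p.1, p.2) from rfl, length_children hj (h.length_le h1) h2 (h.nodup h1) h3]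

/-- The positive queries that appended a vertex of `T`. -/
def foundMeeting (S : SearchState V) (T : Finset V) : Finset (List V × Finset V) :=
  S.found.filter fun p => ∃ v ∈ p.2, v ∈ T

lemma Valid.card_foundMeeting_le (h : S.Valid P roots) (T : Finset V) :
    (S.foundMeeting T).card ≤ T.card * P.D := by
  have : S.foundMeeting T ⊆ T.biUnion fun w => S.found.filter (w ∈ ·.2) := by
    intro p hp
    obtain ⟨hp, v, hv, hvT⟩ := Finset.mem_filter.1 hp
    exact Finset.mem_biUnion.2 ⟨v, hvT, Finset.mem_filter.2 ⟨hp, hv⟩⟩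
  exact (Finset.card_le_card this).trans (Finset.card_biUnion_le_card_mul _ _ _
    fun w _ => h.vertex_card w)

/-- The nodes whose last vertex is in `T`. -/
def seenEndingIn (S : SearchState V) (T : Finset V) : Finset (List V) :=
  S.seen.toFinset.filter fun y => ∃ w ∈ T, y.getLast? = some w

lemma Valid.card_seenEndingIn_le (h : S.Valid P roots) (hP : P.Good) (T : Finset V) :
    (S.seenEndingIn T).card ≤ roots.card + T.card * P.D * P.b.choose P.a := by
  obtain ⟨m, hj⟩ := hP.exists_eq
  have : S.seenEndingIn T ⊆ roots ∪
      (S.foundMeeting T).biUnion fun p => (children P.j P.b P.a p).toFinset := by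
    intro y hy
    obtain ⟨hy, w, hw, hyw⟩ := Finset.mem_filter.1 hy
    rcases h.parent y (by simpa using hy) with h1 | ⟨p, hp, hp'⟩
    · exact Finset.mem_union_left _ h1
    · refine Finset.mem_union_right _ (Finset.mem_biUnion.2 ⟨p, ?_, by simpa using hp'⟩)
      obtain ⟨A, hA, hAc, rfl⟩ := mem_children.1 hp'
      obtain ⟨h1, h2, h3⟩ := h.queried_spec p (h.found_subset hp)
      exact Finset.mem_filter.2 ⟨hp, w, getLast?_extendList_mem hj hP.one_le_a
        (hP.one_le_a.trans hP.a_le_b) (h.length_le h1) h2 hA hAc hyw, hw⟩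
  refine (Finset.card_le_card this).trans ((Finset.card_union_le _ _).trans ?_)
  gcongr
  refine (Finset.card_biUnion_le_card_mul _ _ (P.b.choose P.a) fun p hp => ?_).trans ?_
  · exact h.card_children_le hP (Finset.mem_filter.1 hp).1
  · exact Nat.mul_le_mul_right _ (h.card_foundMeeting_le T)

/-- The nodes whose end set is obtained from `T` by exchanging one vertex. -/
def near (P : SearchParams) (S : SearchState V) (T : Finset V) : Finset (List V) :=
  S.seen.toFinset.filter fun y => (endSet P.j y \ T).card = 1

/-- A bound on the number of nodes that have all but one of their last `j` vertices in common
with a given node. It does not depend on how many nodes there are. -/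
def nearBound (P : SearchParams) (R : ℕ) : ℕ :=
  R + (P.j * P.D + (R + P.j * P.D * P.b.choose P.a) * P.s) * P.b.choose P.a

lemma Valid.card_near_le (h : S.Valid P roots) (hP : P.Good) {T : Finset V} (hT : T.card = P.j) :
    (near P S T).card ≤ nearBound P roots.card := by
  obtain ⟨m, hj⟩ := hP.exists_eq
  have hsub : near P S T ⊆ roots ∪ (S.foundMeeting T ∪ (S.seenEndingIn T).biUnion
      fun z => S.found.filter (·.1 = z)).biUnion
        fun p => (children P.j P.b P.a p).toFinset := by
    intro y hy
    obtain ⟨hy, hc⟩ := Finset.mem_filter.1 hy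
    rcases h.parent y (by simpa using hy) with h1 | ⟨p, hp, hp'⟩
    · exact Finset.mem_union_left _ h1
    · refine Finset.mem_union_right _ (Finset.mem_biUnion.2 ⟨p, ?_, by simpa using hp'⟩)
      obtain ⟨A, hA, hAc, rfl⟩ := mem_children.1 hp'
      obtain ⟨h1, h2, h3⟩ := h.queried_spec p (h.found_subset hp)
      rcases mem_or_getLast?_mem_of_card_sdiff_le hj hP.two_le_j hP.one_le_a hP.a_le_b
        (h.length_le h1) h2 (h.nodup h1) h3 hA hAc hc.le with ⟨v, hv, hvT⟩ | ⟨w, hw, hlw⟩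
      · exact Finset.mem_union_left _ (Finset.mem_filter.2 ⟨hp, v, hv, hvT⟩)
      · refine Finset.mem_union_right _ (Finset.mem_biUnion.2 ⟨p.1, ?_, ?_⟩)
        · exact Finset.mem_filter.2 ⟨by simpa using h1, w, hw, hlw⟩
        · exact Finset.mem_filter.2 ⟨hp, rfl⟩
  refine (Finset.card_le_card hsub).trans ((Finset.card_union_le _ _).trans ?_)
  unfold nearBound
  gcongr
  refine (Finset.card_biUnion_le_card_mul _ _ (P.b.choose P.a) fun p hp => ?_).trans ?_
  · refine h.card_children_le hP ?_
    rcases Finset.mem_union.1 hp with hp | hp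
    · exact (Finset.mem_filter.1 hp).1
    · obtain ⟨z, -, hz⟩ := Finset.mem_biUnion.1 hp
      exact (Finset.mem_filter.1 hz).1
  · refine Nat.mul_le_mul_right _ ((Finset.card_union_le _ _).trans ?_)
    gcongr
    · exact hT ▸ h.card_foundMeeting_le T
    · refine (Finset.card_biUnion_le_card_mul _ _ P.s fun z _ => h.node_card z).trans ?_
      exact Nat.mul_le_mul_right _ (hT ▸ h.card_seenEndingIn_le hP T)

variable [Fintype V]

lemma card_superset_mul_pow_le (b : ℕ) (W : Finset V) :
    (((Finset.univ : Finset V).powersetCard b).filter (W ⊆ ·)).card * Fintype.card V ^ W.card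
      ≤ Fintype.card V ^ b := by
  by_cases hW : W.card ≤ b
  · have h1 : (((Finset.univ : Finset V).powersetCard b).filter (W ⊆ ·)).card ≤
        ((Finset.univ : Finset V).powersetCard (b - W.card)).card := by
      refine Finset.card_le_card_of_injOn (fun N => N \ W) ?_ ?_
      · intro N hN
        obtain ⟨h1, h2⟩ := Finset.mem_filter.1 hN
        have := (Finset.mem_powersetCard.1 h1).2
        refine Finset.mem_coe.2 (Finset.mem_powersetCard.2 ⟨Finset.subset_univ _, ?_⟩)
        rw [Finset.card_sdiff_of_subset h2, this]
      · intro N hN M hM hNM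
        have h1 := (Finset.mem_filter.1 hN).2
        have h2 := (Finset.mem_filter.1 hM).2
        dsimp only at hNM
        rw [← Finset.sdiff_union_of_subset h1, hNM, Finset.sdiff_union_of_subset h2]
    rw [Finset.card_powersetCard, Finset.card_univ] at h1
    calc _ ≤ Fintype.card V ^ (b - W.card) * Fintype.card V ^ W.card :=
          Nat.mul_le_mul_right _ (h1.trans (Nat.choose_le_pow _ _))
      _ = Fintype.card V ^ b := by rw [← pow_add, Nat.sub_add_cancel hW]
  · have : ((Finset.univ : Finset V).powersetCard b).filter (W ⊆ ·) = ∅ := by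
      refine Finset.filter_eq_empty_iff.2 fun N hN hWN => hW ?_
      have := Finset.card_le_card hWN
      rwa [(Finset.mem_powersetCard.1 hN).2] at this
    rw [this]; simp

/-- The sets that may not be appended to a path ending with the `j`-set `T`, since the resulting
edge would contain the end set of another node. -/
def spoiled (P : SearchParams) (S : SearchState V) (T : Finset V) : Finset (Finset V) :=
  ((Finset.univ : Finset V).powersetCard P.b).filter
    fun N => ∃ y ∈ S.seen, endSet P.j y ≠ T ∧ endSet P.j y ⊆ T ∪ N

/-- A node with only one vertex outside `T` spoils a fraction `1 / n` of all sets, a node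
with more vertices outside `T` only a fraction `1 / n ^ 2`. -/
lemma Valid.card_spoiled_le (h : S.Valid P roots) (hP : P.Good) {T : Finset V}
    (hT : T.card = P.j) :
    (spoiled P S T).card * Fintype.card V ^ 2 ≤
      nearBound P roots.card * Fintype.card V ^ (P.b + 1) +
        S.seen.length * Fintype.card V ^ P.b := by
  set n := Fintype.card V
  have hn : 1 ≤ n := by
    have h1 : T.card ≤ n := Finset.card_le_univ T
    have := hP.two_le_j
    omega
  let far : Finset (List V) := S.seen.toFinset.filter fun y => 2 ≤ (endSet P.j y \ T).card
  let f : List V → Finset (Finset V) := fun y =>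
    ((Finset.univ : Finset V).powersetCard P.b).filter (endSet P.j y \ T ⊆ ·)
  have hsub : spoiled P S T ⊆ (near P S T).biUnion f ∪ far.biUnion f := by
    intro N hN
    obtain ⟨hN, y, hy, hyT, hyN⟩ := Finset.mem_filter.1 hN
    have hf : N ∈ f y := Finset.mem_filter.2 ⟨hN, sdiff_le_iff.2 hyN⟩
    have hpos : 0 < (endSet P.j y \ T).card := by
      rw [Finset.card_pos, Finset.sdiff_nonempty]
      intro hs
      refine hyT (Finset.eq_of_subset_of_card_le hs ?_)
      rw [hT, card_endSet (h.length_le hy) (h.nodup hy)]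
    rcases Nat.lt_or_ge 1 (endSet P.j y \ T).card with h1 | h1
    · exact Finset.mem_union_right _ (Finset.mem_biUnion.2
        ⟨y, Finset.mem_filter.2 ⟨by simpa using hy, h1⟩, hf⟩)
    · exact Finset.mem_union_left _ (Finset.mem_biUnion.2
        ⟨y, Finset.mem_filter.2 ⟨by simpa using hy, by omega⟩, hf⟩)
  have h1 : ((near P S T).biUnion f).card * n ^ 2 ≤ nearBound P roots.card * n ^ (P.b + 1) := by
    calc ((near P S T).biUnion f).card * n ^ 2 ≤ (∑ y ∈ near P S T, (f y).card) * n ^ 2 :=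
          Nat.mul_le_mul_right _ Finset.card_biUnion_le
      _ = ∑ y ∈ near P S T, (f y).card * n ^ 2 := Finset.sum_mul _ _ _
      _ ≤ ∑ y ∈ near P S T, n ^ (P.b + 1) := by
          refine Finset.sum_le_sum fun y hy => ?_
          have := card_superset_mul_pow_le P.b (endSet P.j y \ T)
          rw [(Finset.mem_filter.1 hy).2, pow_one] at this
          rw [pow_two, ← mul_assoc, pow_succ]
          exact Nat.mul_le_mul_right _ this
      _ = (near P S T).card * n ^ (P.b + 1) := by simp
      _ ≤ _ := Nat.mul_le_mul_right _ (h.card_near_le hP hT)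
  have h2 : (far.biUnion f).card * n ^ 2 ≤ S.seen.length * n ^ P.b := by
    calc (far.biUnion f).card * n ^ 2 ≤ (∑ y ∈ far, (f y).card) * n ^ 2 :=
          Nat.mul_le_mul_right _ Finset.card_biUnion_le
      _ = ∑ y ∈ far, (f y).card * n ^ 2 := Finset.sum_mul _ _ _
      _ ≤ ∑ y ∈ far, n ^ P.b := by
          refine Finset.sum_le_sum fun y hy => ?_
          refine le_trans ?_ (card_superset_mul_pow_le P.b (endSet P.j y \ T))
          exact Nat.mul_le_mul_left _ (Nat.pow_le_pow_right hn (Finset.mem_filter.1 hy).2)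
      _ = far.card * n ^ P.b := by simp
      _ ≤ _ := Nat.mul_le_mul_right _
          ((Finset.card_filter_le _ _).trans (List.toFinset_card_le _))
  calc _ ≤ (((near P S T).biUnion f).card + (far.biUnion f).card) * n ^ 2 :=
        Nat.mul_le_mul_right _ ((Finset.card_le_card hsub).trans (Finset.card_union_le _ _))
    _ ≤ _ := by rw [add_mul]; exact Nat.add_le_add h1 h2

/-- The vertices that must not be appended any more. -/
def saturated (P : SearchParams) (S : SearchState V) : Finset V :=
  Finset.univ.filter fun w => P.D ≤ (S.found.filter (w ∈ ·.2)).card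

lemma Valid.card_saturated_mul_le (h : S.Valid P roots) :
    (saturated P S).card * P.D ≤ P.b * S.found.card := by
  calc (saturated P S).card * P.D = ∑ w ∈ saturated P S, P.D := by simp
    _ ≤ ∑ w ∈ saturated P S, (S.found.filter (w ∈ ·.2)).card :=
        Finset.sum_le_sum fun w hw => (Finset.mem_filter.1 hw).2
    _ ≤ ∑ w : V, (S.found.filter (w ∈ ·.2)).card :=
        Finset.sum_le_sum_of_subset (Finset.subset_univ _)
    _ = ∑ p ∈ S.found, (Finset.univ.filter fun w => w ∈ p.2).card :=
        Finset.sum_card_bipartiteAbove_eq_sum_card_bipartiteBelow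
          (fun (w : V) (p : List V × Finset V) => w ∈ p.2)
    _ = ∑ p ∈ S.found, P.b := by
        refine Finset.sum_congr rfl fun p hp => ?_
        rw [← (h.queried_spec p (h.found_subset hp)).2.1, Finset.filter_univ_mem]
    _ = P.b * S.found.card := by simp [mul_comm]

/-- If no query at `x` is admissible any more, then every set of `b` vertices that avoids the path
and the saturated vertices is spoiled or has been queried. -/
lemma choose_le_of_not_admissible {x : List V}
    (hno : ∀ N, ¬ S.Admissible P x N) :
    (Fintype.card V - x.length - (saturated P S).card).choose P.b ≤
      (S.queried.filter (·.1 = x)).card + (spoiled P S (endSet P.j x)).card := by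
  set U : Finset V := (Finset.univ \ x.toFinset) \ saturated P S with hU
  have hUc : Fintype.card V - x.length - (saturated P S).card ≤ U.card := by
    have h1 : _ ≤ U.card := Finset.le_card_sdiff (saturated P S) (Finset.univ \ x.toFinset)
    have h2 := Finset.le_card_sdiff x.toFinset (Finset.univ : Finset V)
    have h3 := List.toFinset_card_le x
    rw [Finset.card_univ] at h2
    omega
  have hsub : U.powersetCard P.b ⊆ ((S.queried.filter (·.1 = x)).image Prod.snd) ∪
      spoiled P S (endSet P.j x) := by
    intro N hN
    obtain ⟨h1, h2⟩ := Finset.mem_powersetCard.1 hN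
    by_contra hcon
    rw [Finset.mem_union, not_or] at hcon
    refine hno N ⟨h2, ?_, ?_, ?_, ?_⟩
    · intro v hv
      have := h1 hv
      simp only [hU, Finset.mem_sdiff, Finset.mem_univ, true_and, List.mem_toFinset] at this
      exact this.1
    · intro v hv
      have := h1 hv
      simp only [hU, saturated, Finset.mem_sdiff, Finset.mem_univ, true_and, Finset.mem_filter,
        not_le] at this
      exact this.2
    · intro hq
      exact hcon.1 (Finset.mem_image.2 ⟨(x, N), Finset.mem_filter.2 ⟨hq, rfl⟩, rfl⟩)
    · intro y hy hyx hyN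
      exact hcon.2 (Finset.mem_filter.2 ⟨Finset.mem_powersetCard.2 ⟨Finset.subset_univ _, h2⟩,
        y, hy, hyx, hyN⟩)
  calc _ ≤ U.card.choose P.b := Nat.choose_le_choose _ hUc
    _ = (U.powersetCard P.b).card := (Finset.card_powersetCard _ _).symm
    _ ≤ _ := (Finset.card_le_card hsub).trans ((Finset.card_union_le _ _).trans
        (Nat.add_le_add_right Finset.card_image_le _))

end SearchState

end Spoiled

/-! ### The supermartingale -/

/-- The probability that a random set agrees with `T` on the finite set `Q`. -/
lemma setBernoulli_real_agree {ι : Type*} [DecidableEq ι] (u : Set ι) (p : unitInterval)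
    {Q T : Finset ι} (hQ : ∀ q ∈ Q, q ∈ u) (hT : T ⊆ Q) :
    (setBernoulli u p).real {H | ∀ q ∈ Q, (q ∈ H ↔ q ∈ T)} =
      (p : ℝ) ^ T.card * (1 - p : ℝ) ^ (Q.card - T.card) := by
  have hpre : ((fun f : ι → Prop => {i | f i}) ⁻¹' {H : Set ι | ∀ q ∈ Q, (q ∈ H ↔ q ∈ T)}) =
      Set.pi (Q : Set ι) (fun q => {x : Prop | x ↔ q ∈ T}) := by
    ext f
    simp [Set.mem_pi]
  rw [measureReal_def, setBernoulli_apply', hpre, Measure.infinitePi_pi]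
  · have hfac : ∀ q ∈ Q, (unitInterval.toNNReal p • Measure.dirac (q ∈ u) +
        unitInterval.toNNReal (unitInterval.symm p) • Measure.dirac False)
          {x : Prop | x ↔ q ∈ T} =
        if q ∈ T then (unitInterval.toNNReal p : ENNReal)
          else (unitInterval.toNNReal (unitInterval.symm p) : ENNReal) := by
      intro q hq
      have := hQ q hq
      by_cases hqT : q ∈ T <;> simp [hqT, this]
    rw [Finset.prod_congr rfl hfac, Finset.prod_ite, Finset.prod_const, Finset.prod_const]
    have h1 : Q.filter (· ∈ T) = T := by
      ext q; simp only [Finset.mem_filter]; exact ⟨fun h => h.2, fun h => ⟨hT h, h⟩⟩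
    have h2 : (Q.filter (· ∉ T)).card = Q.card - T.card := by
      rw [← Finset.card_sdiff_of_subset hT]
      congr 1
      ext q; simp
    rw [h1, h2]
    simp
  · intro i _
    exact MeasurableSet.of_discrete

section Supermartingale

variable {V : Type*} [DecidableEq V]

namespace SearchState

variable {P : SearchParams} {roots : Finset (List V)} {S : SearchState V}

/-- The hypergraphs that answer all the queries as recorded in `S`. -/
def consistent (j : ℕ) (S : SearchState V) : Set (Set (Finset V)) :=
  {H | ∀ q ∈ S.queried, (queryEdge j q ∈ H ↔ q ∈ S.found)}

lemma Valid.card_queryEdge (h : S.Valid P roots) {q : List V × Finset V} (hq : q ∈ S.queried) :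
    (queryEdge P.j q).card = P.j + P.b := by
  obtain ⟨h1, h2, h3⟩ := h.queried_spec q hq
  unfold queryEdge
  rw [Finset.card_union_of_disjoint, card_endSet (h.length_le h1) (h.nodup h1), h2]
  rw [Finset.disjoint_left]
  intro v hv hv'
  exact h3 v hv' (by simpa using endSet_subset hv)

lemma Valid.measure_consistent (h : S.Valid P roots) (p : unitInterval) :
    (setBernoulli {e : Finset V | e.card = P.j + P.b} p).real (consistent P.j S) =
      (p : ℝ) ^ S.found.card * (1 - p : ℝ) ^ (S.queried.card - S.found.card) := by
  have hinj' : Set.InjOn (queryEdge P.j) (S.found : Set (List V × Finset V)) :=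
    h.edge_inj.mono (by exact_mod_cast h.found_subset)
  have := setBernoulli_real_agree {e : Finset V | e.card = P.j + P.b} p
    (Q := S.queried.image (queryEdge P.j)) (T := S.found.image (queryEdge P.j))
    (by
      intro e he
      obtain ⟨q, hq, rfl⟩ := Finset.mem_image.1 he
      exact h.card_queryEdge hq)
    (Finset.image_subset_image h.found_subset)
  rw [Finset.card_image_of_injOn h.edge_inj, Finset.card_image_of_injOn hinj'] at this
  rw [← this]
  congr 1
  ext H
  simp only [consistent, Set.mem_ofPred_eq, Finset.forall_mem_image]
  refine forall₂_congr fun q hq => ?_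
  have : queryEdge P.j q ∈ S.found.image (queryEdge P.j) ↔ q ∈ S.found := by
    constructor
    · intro hm
      obtain ⟨q', hq', he⟩ := Finset.mem_image.1 hm
      exact h.edge_inj (h.found_subset hq') hq he ▸ hq'
    · exact Finset.mem_image_of_mem _
  rw [this]

lemma Valid.hasTightPath_of_consistent (h : S.Valid P roots) {y : List V} (hy : y ∈ S.seen)
    {L : ℕ} (hb : 1 ≤ P.b) (hL : P.j + P.b * L ≤ y.length) {H : Set (Finset V)}
    (hH : H ∈ consistent P.j S) : ∃ ℓ ≥ L, HasTightPath (P.j + P.b) P.j H ℓ := by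
  obtain ⟨ℓ, hℓ⟩ := h.path y hy
  refine ⟨ℓ, ?_, hℓ.hasTightPath ?_⟩
  · rw [hℓ.length_eq] at hL
    exact Nat.le_of_mul_le_mul_left (by omega) hb
  · intro e he
    obtain ⟨q, hq, rfl⟩ := Finset.mem_image.1 (Finset.mem_coe.1 he)
    exact (hH q (h.found_subset hq)).2 hq

variable [Fintype V]

lemma Valid.card_queried_le (h : S.Valid P roots) : S.queried.card ≤ 2 ^ Fintype.card V := by
  rw [← Finset.card_image_of_injOn h.edge_inj, ← Fintype.card_finset]
  exact Finset.card_le_univ _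

/-- The potential `lam ^ (found edges) * β ^ (queries)` is a supermartingale along the search.
If it is at least `Φ` whenever the search stops without success, then the search fails with
probability at most the initial potential divided by `Φ`. The proof is by induction on the states
with probabilities conditional on the answers obtained so far. -/
theorem Valid.measure_noPath_mul_le (hP : P.Good) (p : unitInterval) {L Xmax : ℕ}
    {lam β Φ : ℝ} (hlam : 0 ≤ lam) (hβ : 0 ≤ β) (hmart : p * (lam * β) + (1 - p) * β ≤ 1)
    (hfull : ∀ S : SearchState V, S.Valid P roots → S.found.card ≤ Xmax → ∀ x ∈ S.seen,
      x.length ≤ P.j + P.b * L → (∀ N, ¬ S.Admissible P x N) →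
      P.q ≤ (S.queried.filter (·.1 = x)).card)
    (hhalt : ∀ S : SearchState V, S.Valid P roots →
      (∀ x ∈ S.stack, x.length ≤ P.j + P.b * L) → (S.stack = [] ∨ S.found.card = Xmax) →
      Φ ≤ lam ^ S.found.card * β ^ S.queried.card)
    (S : SearchState V) (h : S.Valid P roots) (hX : S.found.card ≤ Xmax) :
    (setBernoulli {e : Finset V | e.card = P.j + P.b} p).real
        (consistent P.j S ∩ {H | ∀ ℓ ≥ L, ¬ HasTightPath (P.j + P.b) P.j H ℓ}) * Φ ≤
      (setBernoulli {e : Finset V | e.card = P.j + P.b} p).real (consistent P.j S) *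
        (lam ^ S.found.card * β ^ S.queried.card) := by
  have hb : 1 ≤ P.b := hP.one_le_a.trans hP.a_le_b
  -- a query decreases the first summand by `C + 1` and adds at most `C` nodes to the stack
  induction hM : (2 ^ Fintype.card V - S.queried.card) * (P.b.choose P.a + 1) + S.stack.length
    using Nat.strong_induction_on generalizing S with
  | _ M ih =>
  set μ := setBernoulli {e : Finset V | e.card = P.j + P.b} p with hμ
  set bad := {H : Set (Finset V) | ∀ ℓ ≥ L, ¬ HasTightPath (P.j + P.b) P.j H ℓ} with hbad
  have hpot : 0 ≤ lam ^ S.found.card * β ^ S.queried.card := by positivity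
  by_cases hsucc : ∃ y ∈ S.stack, P.j + P.b * L ≤ y.length
  -- a node with a long path: all consistent hypergraphs contain it
  · obtain ⟨y, hy, hyL⟩ := hsucc
    have hempty : consistent P.j S ∩ bad = ∅ := by
      ext H
      simp only [Set.mem_inter_iff, Set.mem_empty_iff_false, iff_false, not_and]
      intro hH hB
      obtain ⟨ℓ, hℓ, hp⟩ := h.hasTightPath_of_consistent (mem_seen_of_mem_stack hy) hb hyL hH
      exact hB ℓ hℓ hp
    rw [hempty]
    simp only [measureReal_empty, zero_mul]
    positivity
  push Not at hsucc
  have hstack : ∀ x ∈ S.stack, x.length ≤ P.j + P.b * L := fun x hx => (hsucc x hx).le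
  by_cases hend : S.stack = [] ∨ S.found.card = Xmax
  · have h1 := hhalt S h hstack hend
    calc μ.real (consistent P.j S ∩ bad) * Φ
        ≤ μ.real (consistent P.j S ∩ bad) * (lam ^ S.found.card * β ^ S.queried.card) := by gcongr
      _ ≤ _ := mul_le_mul_of_nonneg_right (measureReal_mono Set.inter_subset_left) hpot
  push Not at hend
  obtain ⟨hne, hXne⟩ := hend
  obtain ⟨x, rest, hst⟩ := List.exists_cons_of_ne_nil hne
  have hxs : x ∈ S.stack := by simp [hst]
  have hx := mem_seen_of_mem_stack hxs
  -- giving up the current node changes neither the event nor the potential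
  by_cases hcap : P.s ≤ (S.found.filter (·.1 = x)).card
  · have := fun hlt => ih _ hlt _ (h.pop_capped hst hcap) hX rfl
    exact this (by rw [← hM]; simp [hst])
  by_cases hadm : ∀ N, ¬ S.Admissible P x N
  · have := fun hlt =>
      ih _ hlt _ (h.pop_full hst (hfull S h hX x hx (hstack x hxs) hadm)) hX rfl
    exact this (by rw [← hM]; simp [hst])
  push Not at hadm hcap
  -- otherwise `(x, N)` is queried, and the induction hypothesis applies to both answers
  obtain ⟨N, hN⟩ := hadm
  have hyes := h.query_yes hP hst hN hcap
  have hno := h.query_no hx hN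
  have hnq := hN.notMem_queried
  have hnf : (x, N) ∉ S.found := fun hf => hnq (h.found_subset hf)
  have hcq : (insert (x, N) S.queried).card = S.queried.card + 1 :=
    Finset.card_insert_of_notMem hnq
  have hcf : (insert (x, N) S.found).card = S.found.card + 1 :=
    Finset.card_insert_of_notMem hnf
  have hle : S.found.card ≤ S.queried.card := Finset.card_le_card h.found_subset
  have hlt : S.queried.card + 1 ≤ 2 ^ Fintype.card V := by
    have := hno.card_queried_le
    simpa only [hcq] using this
  obtain ⟨d, hd⟩ := Nat.exists_eq_add_of_le hlt
  have hm1 : 2 ^ Fintype.card V - S.queried.card = d + 1 := by omega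
  have hm2 : 2 ^ Fintype.card V - (S.queried.card + 1) = d := by omega
  have hlc : (children P.j P.b P.a (x, N)).length = P.b.choose P.a := by
    obtain ⟨m, hj⟩ := hP.exists_eq
    exact length_children hj (h.length_le hx) hN.card_eq (h.nodup hx) hN.notMem
  have ih1 := fun hlt => ih _ hlt _ hyes (by simp only [hcf]; omega) rfl
  have ih2 := fun hlt => ih _ hlt _ hno hX rfl
  specialize ih1 (by
    rw [← hM]
    simp only [hcq, hm1, hm2, List.length_append, hlc]
    ring_nf
    omega)
  specialize ih2 (by
    rw [← hM]
    simp only [hcq, hm1, hm2]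
    ring_nf
    omega)
  have mu0 := h.measure_consistent p
  have mu1 := hyes.measure_consistent p
  have mu2 := hno.measure_consistent p
  rw [← hμ] at mu0 mu1 mu2
  simp only [hcq, hcf] at ih1 ih2 mu1 mu2
  have e1 : S.queried.card + 1 - (S.found.card + 1) = S.queried.card - S.found.card := by omega
  have e2 : S.queried.card + 1 - S.found.card = (S.queried.card - S.found.card) + 1 := by omega
  rw [e1, pow_succ] at mu1
  rw [e2, pow_succ] at mu2
  rw [mu1] at ih1
  rw [mu2] at ih2
  have hp0 : (0 : ℝ) ≤ p := p.2.1
  have hp1 : (0 : ℝ) ≤ 1 - p := by linarith [p.2.2]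
  by_cases hΦ : Φ ≤ 0
  · refine (mul_nonpos_of_nonneg_of_nonpos measureReal_nonneg hΦ).trans ?_
    positivity
  push Not at hΦ
  have hsplit : μ.real (consistent P.j S ∩ bad) ≤
      μ.real (consistent P.j ⟨children P.j P.b P.a (x, N) ++ S.stack, S.full, S.capped,
        insert (x, N) S.found, insert (x, N) S.queried⟩ ∩ bad) +
      μ.real (consistent P.j ⟨S.stack, S.full, S.capped, S.found,
        insert (x, N) S.queried⟩ ∩ bad) := by
    refine le_trans (measureReal_mono ?_) (measureReal_union_le _ _)
    rintro H ⟨hH, hHb⟩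
    by_cases he : queryEdge P.j (x, N) ∈ H
    · refine Or.inl ⟨?_, hHb⟩
      intro q hq
      rcases Finset.mem_insert.1 hq with rfl | hq
      · simpa using he
      · have hqx : q ≠ (x, N) := fun h => hnq (h ▸ hq)
        rw [hH q hq, Finset.mem_insert]
        simp [hqx]
    · refine Or.inr ⟨?_, hHb⟩
      intro q hq
      rcases Finset.mem_insert.1 hq with rfl | hq
      · simpa [hnf] using he
      · exact hH q hq
  set w := (p : ℝ) ^ S.found.card * (1 - p : ℝ) ^ (S.queried.card - S.found.card) with hw
  have hw0 : 0 ≤ w := by positivity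
  rw [mu0]
  calc μ.real (consistent P.j S ∩ bad) * Φ ≤ _ * Φ := mul_le_mul_of_nonneg_right hsplit hΦ.le
    _ ≤ w * (lam ^ S.found.card * β ^ S.queried.card) * (p * (lam * β) + (1 - p) * β) := by
        rw [add_mul]
        refine (add_le_add ih1 ih2).trans (le_of_eq ?_)
        rw [hw]
        ring
    _ ≤ w * (lam ^ S.found.card * β ^ S.queried.card) * 1 := by gcongr
    _ = _ := mul_one _

end SearchState

end Supermartingale

/-! ### The probability of failure for a fixed number of vertices -/

section Failure

variable {V : Type*} [DecidableEq V]

namespace SearchState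

variable {P : SearchParams} {roots : Finset (List V)} {S : SearchState V}

/-- Bookkeeping: every edge found yields `C` nodes, each of which is still on the stack, or has cost
`q` queries, or has cost `s` edges. -/
lemma Valid.pow_le_potential (h : S.Valid P roots) {lam β g κ : ℝ} (hβ : 1 ≤ β)
    (hg : 1 ≤ g) (hκ : 0 ≤ κ) (hgq : g ≤ β ^ P.q)
    (hκg : 1 + κ ≤ lam * g ^ P.b.choose P.a) (hs : g ^ 2 ≤ (1 + κ) ^ P.s) :
    (1 + κ) ^ S.found.card * g ^ (2 * roots.card) ≤
      (lam ^ S.found.card * β ^ S.queried.card) ^ 2 * g ^ (2 * S.stack.length) := by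
  set X := S.found.card with hX
  have hg0 : 0 ≤ g := by linarith
  have h1 : g ^ S.full.length ≤ β ^ S.queried.card :=
    calc g ^ S.full.length ≤ (β ^ P.q) ^ S.full.length := by gcongr
      _ = β ^ (P.q * S.full.length) := (pow_mul _ _ _).symm
      _ ≤ β ^ S.queried.card := pow_le_pow_right₀ hβ h.mul_full_le
  have h2 : g ^ (2 * S.capped.length) ≤ (1 + κ) ^ X :=
    calc g ^ (2 * S.capped.length) = (g ^ 2) ^ S.capped.length := pow_mul _ _ _
      _ ≤ ((1 + κ) ^ P.s) ^ S.capped.length := by gcongr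
      _ = (1 + κ) ^ (P.s * S.capped.length) := (pow_mul _ _ _).symm
      _ ≤ _ := pow_le_pow_right₀ (by linarith) h.mul_capped_le
  have hcount : S.stack.length + S.full.length + S.capped.length =
      P.b.choose P.a * X + roots.card := by
    rw [← h.count]; simp [seen, add_assoc]
  have hpos : 0 < (1 + κ) ^ X := by positivity
  refine le_of_mul_le_mul_right ?_ hpos
  calc (1 + κ) ^ X * g ^ (2 * roots.card) * (1 + κ) ^ X
      = ((1 + κ) ^ X) ^ 2 * g ^ (2 * roots.card) := by ring
    _ ≤ ((lam * g ^ P.b.choose P.a) ^ X) ^ 2 * g ^ (2 * roots.card) := by gcongr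
    _ = (lam ^ X) ^ 2 * (g ^ (P.b.choose P.a * X + roots.card)) ^ 2 := by
        rw [mul_pow lam, ← pow_mul g, pow_add]
        ring
    _ = (lam ^ X) ^ 2 * (g ^ S.full.length) ^ 2 * g ^ (2 * S.stack.length) *
          g ^ (2 * S.capped.length) := by
        rw [← hcount]; ring
    _ ≤ (lam ^ X) ^ 2 * (β ^ S.queried.card) ^ 2 * g ^ (2 * S.stack.length) * (1 + κ) ^ X := by
        gcongr
    _ = _ := by ring

variable [Fintype V]

/-- A quantitative bound for fixed `n`. With `lam = 1 - u` the potential increases by a factor of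
at least `1 + κ` for each edge found, apart from what the nodes on the stack account for. -/
theorem measure_noPath_mul_le_one (hP : P.Good) (p : unitInterval)
    (hlen : ∀ y ∈ roots, y.length = P.j) (hnd : ∀ y ∈ roots, y.Nodup)
    (hinj : Set.InjOn (endSet P.j) (roots : Set (List V))) {L Xmax : ℕ} {u g κ : ℝ}
    (hu0 : 0 ≤ u) (hu1 : u < 1) (hg : 1 ≤ g) (hgq : g ≤ 1 + P.q * (p * u)) (hκ : 0 ≤ κ)
    (hκg : 1 + κ ≤ (1 - u) * g ^ P.b.choose P.a) (hs : g ^ 2 ≤ (1 + κ) ^ P.s)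
    (hX : g ^ (2 * (roots.card + P.b.choose P.a * L)) ≤ (1 + κ) ^ Xmax) (hD : 0 < P.D)
    (hq : ∀ sp : ℕ, sp * Fintype.card V ^ 2 ≤
        nearBound P roots.card * Fintype.card V ^ (P.b + 1) +
          (P.b.choose P.a * Xmax + roots.card) * Fintype.card V ^ P.b →
      P.q + sp ≤ (Fintype.card V - (P.j + P.b * L) - P.b * Xmax / P.D).choose P.b) :
    (setBernoulli {e : Finset V | e.card = P.j + P.b} p).real
      {H | ∀ ℓ ≥ L, ¬ HasTightPath (P.j + P.b) P.j H ℓ} * g ^ roots.card ≤ 1 := by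
  have hb : 1 ≤ P.b := hP.one_le_a.trans hP.a_le_b
  have hp0 : (0 : ℝ) ≤ p := p.2.1
  have hp1 : (p : ℝ) ≤ 1 := p.2.2
  have hg0 : 0 ≤ g := by linarith
  have hpu : (p : ℝ) * u < 1 := by nlinarith
  have hpu0 : 0 ≤ (p : ℝ) * u := by positivity
  set β : ℝ := 1 / (1 - p * u) with hβdef
  have hβ1 : 1 + p * u ≤ β := by
    rw [hβdef, le_div_iff₀ (by linarith)]
    nlinarith
  have hβ : 1 ≤ β := by linarith
  have hmart : (p : ℝ) * ((1 - u) * β) + (1 - p) * β ≤ 1 := by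
    have : β * (1 - p * u) = 1 := by
      rw [hβdef]; field_simp [(by linarith : (1 : ℝ) - p * u ≠ 0)]
    linarith
  have hgβ : g ≤ β ^ P.q :=
    calc g ≤ 1 + P.q * (p * u) := hgq
      _ ≤ (1 + p * u) ^ P.q := one_add_mul_le_pow (by linarith) _
      _ ≤ β ^ P.q := by gcongr
  have key := Valid.measure_noPath_mul_le hP p (L := L) (Xmax := Xmax) (lam := 1 - u) (β := β)
    (Φ := g ^ roots.card) (roots := roots) (by linarith) (by linarith) hmart ?_ ?_ (init roots)
    (valid_init hlen hnd hinj) (by simp [init])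
  · have huniv : consistent P.j (init roots) = Set.univ := by
      ext H; simp [consistent, init]
    rw [huniv, Set.univ_inter] at key
    simpa [init] using key
  · intro S h hSX x hx hxL hno
    have h1 := choose_le_of_not_admissible hno
    have hT : (endSet P.j x).card = P.j := card_endSet (h.length_le hx) (h.nodup hx)
    have h2 := h.card_spoiled_le hP hT
    have h3 : (saturated P S).card ≤ P.b * Xmax / P.D := by
      rw [Nat.le_div_iff_mul_le hD]
      exact h.card_saturated_mul_le.trans (Nat.mul_le_mul_left _ hSX)
    have h4 := hq _ (h2.trans (by rw [h.count]; gcongr))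
    have h5 : (Fintype.card V - (P.j + P.b * L) - P.b * Xmax / P.D).choose P.b ≤
        (Fintype.card V - x.length - (saturated P S).card).choose P.b :=
      Nat.choose_le_choose _ (by omega)
    omega
  · intro S h hstack hend
    have hpow := h.pow_le_potential (lam := 1 - u) hβ hg hκ hgβ hκg hs
    have hφ : 0 ≤ (1 - u) ^ S.found.card * β ^ S.queried.card := by
      have : 0 ≤ 1 - u := by linarith
      positivity
    refine le_of_sq_le_sq ?_ hφ
    rw [← pow_mul, mul_comm _ 2]
    -- either the stack is empty, or its at most `R + C * L` nodes are outweighed by `Xmax` edges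
    rcases hend with hst | hXe
    · rw [hst] at hpow
      simp only [List.length_nil, mul_zero, pow_zero, mul_one] at hpow
      refine le_trans ?_ hpow
      have : 1 ≤ (1 + κ) ^ S.found.card := one_le_pow₀ (by linarith)
      nlinarith [pow_nonneg hg0 (2 * roots.card)]
    · have hact : S.stack.length ≤ roots.card + P.b.choose P.a * L := by
        have hbd := h.bound
        rcases hst : S.stack with _ | ⟨x, rest⟩
        · simp
        · rw [hst] at hbd
          have h1 := hbd.1
          have h2 := hstack x (by simp [hst])
          have h3 : P.b.choose P.a * x.length ≤ P.b.choose P.a * (P.j + P.b * L) :=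
            Nat.mul_le_mul_left _ h2
          rw [List.length_cons]
          refine Nat.le_of_mul_le_mul_left ?_ hb
          nlinarith
      have hgpos : 0 < g ^ (2 * (roots.card + P.b.choose P.a * L)) := by positivity
      refine le_of_mul_le_mul_right ?_ hgpos
      calc g ^ (2 * roots.card) * g ^ (2 * (roots.card + P.b.choose P.a * L))
          ≤ g ^ (2 * roots.card) * (1 + κ) ^ Xmax := by gcongr
        _ = (1 + κ) ^ S.found.card * g ^ (2 * roots.card) := by rw [hXe]; ring
        _ ≤ _ := hpow
        _ ≤ _ := by gcongr

end SearchState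

end Failure

/-! ### Asymptotics -/

lemma add_one_le_choose {j : ℕ} (hj : 1 ≤ j) (t : ℕ) : t + 1 ≤ (j + t).choose j := by
  obtain ⟨i, rfl⟩ := Nat.exists_eq_add_of_le' hj
  induction t with
  | zero => simp
  | succ t ih =>
    have h1 : 0 < (i + 1 + t).choose i := Nat.choose_pos (by omega)
    rw [← add_assoc, Nat.choose_succ_succ]
    simp only [Nat.succ_eq_add_one]
    omega

lemma exists_roots {n j R : ℕ} (hj : 1 ≤ j) (hR : R + j ≤ n) :
    ∃ roots : Finset (List (Fin n)), roots.card = R ∧ (∀ y ∈ roots, y.length = j) ∧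
      (∀ y ∈ roots, y.Nodup) ∧ Set.InjOn (endSet j) (roots : Set (List (Fin n))) := by
  have hle : R ≤ ((Finset.univ : Finset (Fin n)).powersetCard j).card := by
    rw [Finset.card_powersetCard, Finset.card_univ, Fintype.card_fin]
    obtain ⟨t, rfl⟩ := Nat.exists_eq_add_of_le (show j ≤ n by omega)
    have := add_one_le_choose hj t
    omega
  obtain ⟨F, hF, hFc⟩ := Finset.exists_subset_card_eq hle
  have hend : ∀ J ∈ F, endSet j J.toList = J := by
    intro J hJ
    have := (Finset.mem_powersetCard.1 (hF hJ)).2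
    simp [endSet, this]
  refine ⟨F.image Finset.toList, ?_, ?_, ?_, ?_⟩
  · rw [Finset.card_image_of_injOn, hFc]
    intro J _ J' _ h
    have := congrArg List.toFinset h
    simpa using this
  · intro y hy
    obtain ⟨J, hJ, rfl⟩ := Finset.mem_image.1 hy
    simpa using (Finset.mem_powersetCard.1 (hF hJ)).2
  · intro y hy
    obtain ⟨J, hJ, rfl⟩ := Finset.mem_image.1 hy
    exact Finset.nodup_toList _
  · intro y hy z hz h
    obtain ⟨J, hJ, rfl⟩ := Finset.mem_image.1 (Finset.mem_coe.1 hy)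
    obtain ⟨J', hJ', rfl⟩ := Finset.mem_image.1 (Finset.mem_coe.1 hz)
    rw [hend J hJ, hend J' hJ'] at h
    rw [h]

lemma tendsto_nat_sqrt : Tendsto Nat.sqrt atTop atTop := by
  refine tendsto_atTop.2 fun B => ?_
  filter_upwards [eventually_ge_atTop (B * B)] with n hn
  exact Nat.le_sqrt.2 hn

lemma tendsto_inv_nat_sqrt : Tendsto (fun n : ℕ => 1 / (Nat.sqrt n : ℝ)) atTop (𝓝 0) :=
  tendsto_one_div_atTop_nhds_zero_nat.comp tendsto_nat_sqrt

lemma spoiled_le {b A B K n r sp : ℕ} (hn : 0 < n) (hr : 0 < r) (hrn : r * r ≤ n)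
    (hsp : sp * n ^ 2 ≤ r * A * n ^ (b + 1) + (B * (K * n) + r) * n ^ b) :
    (sp : ℝ) ≤ (n : ℝ) ^ b * (A * (1 / (r : ℝ)) + (B * K + 1) * (1 / (n : ℝ))) := by
  have hn' : (0 : ℝ) < n := by exact_mod_cast hn
  have hr' : (0 : ℝ) < r := by exact_mod_cast hr
  have hr1 : (1 : ℝ) ≤ r := by exact_mod_cast hr
  have hrn' : (r : ℝ) * r ≤ n := by exact_mod_cast hrn
  have h2 : (sp : ℝ) * n ^ 2 ≤ r * A * n ^ (b + 1) + (B * (K * n) + r) * n ^ b := by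
    exact_mod_cast hsp
  have h3 : (r : ℝ) ≤ n := by nlinarith
  have h4 : (r : ℝ) * n ≤ n ^ 2 * (1 / r) := by
    rw [mul_one_div, le_div_iff₀ hr']
    nlinarith
  have h5 : (n : ℝ) ^ b * (A * (1 / (r : ℝ)) + (B * K + 1) * (1 / (n : ℝ))) * n ^ 2 =
      A * (n ^ 2 * (1 / r)) * n ^ b + (B * K * n + n) * n ^ b * ((1 / (n : ℝ)) * n) := by
    ring
  rw [one_div_mul_cancel hn'.ne', mul_one] at h5
  refine le_of_mul_le_mul_right ?_ (by positivity : (0 : ℝ) < (n : ℝ) ^ 2)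
  rw [h5]
  refine h2.trans (add_le_add ?_ ?_)
  · calc (r : ℝ) * A * n ^ (b + 1) = A * (r * n) * n ^ b := by ring
      _ ≤ A * (n ^ 2 * (1 / r)) * n ^ b := by gcongr
  · have : (B * (K * n) + r : ℝ) ≤ B * K * n + n := by linarith
    gcongr

/-- If the paths considered cover at most a proportion `θ₀ < θ` of the vertices, then for large `n`
there is room for `q` queries even after all the spoiled sets have been discarded. -/
lemma eventually_room {b j A B K : ℕ} (hb : 1 ≤ b) {c ε θ₀ θ : ℝ} (hc : 0 < c) (hε : 0 < ε)
    (hθ : θ₀ < θ) (hθ1 : θ < 1) (hcθ : 1 + ε < c * (1 - θ) ^ b)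
    {cn : ℕ → ℝ} (hcn : Tendsto cn atTop (𝓝 c)) {q L : ℕ → ℕ}
    (hq : ∀ᶠ n in atTop, (q n : ℝ) ≤ (1 + ε) / cn n * (n.choose b : ℝ) + 1)
    (hL : ∀ᶠ n in atTop, (b * L n : ℝ) ≤ θ₀ * (n : ℝ) + b) :
    ∀ᶠ n : ℕ in atTop, ∀ sp : ℕ, sp * n ^ 2 ≤
        Nat.sqrt n * A * n ^ (b + 1) + (B * (K * n) + Nat.sqrt n) * n ^ b →
      q n + sp ≤ (n - (j + b * L n) - b * (K * n) / Nat.sqrt n).choose b := by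
  have hinv : Tendsto (fun n : ℕ => 1 / (n : ℝ)) atTop (𝓝 0) := tendsto_one_div_atTop_nhds_zero_nat
  have hsq := tendsto_inv_nat_sqrt
  have hlhs : Tendsto (fun n : ℕ => (1 + ε) / cn n + (b.factorial : ℝ) * (1 / (n : ℝ)) +
      b.factorial * (A * (1 / (Nat.sqrt n : ℝ)) + (B * K + 1) * (1 / (n : ℝ)))) atTop
      (𝓝 ((1 + ε) / c + (b.factorial : ℝ) * 0 + b.factorial * (A * 0 + (B * K + 1) * 0))) :=
    ((tendsto_const_nhds.div hcn hc.ne').add (hinv.const_mul _)).add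
      (((hsq.const_mul _).add (hinv.const_mul _)).const_mul _)
  have hrhs : Tendsto (fun n : ℕ => (1 - θ - b * (1 / (n : ℝ))) ^ b) atTop
      (𝓝 ((1 - θ - b * 0) ^ b)) :=
    (tendsto_const_nhds.sub (hinv.const_mul _)).pow _
  have hlt : (1 + ε) / c + (b.factorial : ℝ) * 0 + b.factorial * (A * 0 + (B * K + 1) * 0) <
      (1 - θ - b * 0) ^ b := by
    simp only [mul_zero, add_zero, sub_zero]
    rw [div_lt_iff₀ hc]
    linarith
  have hroom : Tendsto (fun n : ℕ => (j + b : ℝ) * (1 / (n : ℝ)) +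
      (b * K : ℝ) * (1 / (Nat.sqrt n : ℝ))) atTop (𝓝 ((j + b : ℝ) * 0 + (b * K : ℝ) * 0)) :=
    (hinv.const_mul _).add (hsq.const_mul _)
  have hbase : Tendsto (fun n : ℕ => 1 - θ - b * (1 / (n : ℝ))) atTop (𝓝 (1 - θ - b * 0)) :=
    tendsto_const_nhds.sub (hinv.const_mul _)
  filter_upwards [hlhs.eventually_lt hrhs hlt, hq, hL, eventually_gt_atTop 0,
    hroom.eventually_lt_const (by simp; linarith : _ < θ - θ₀),
    hbase.eventually_const_lt (by simp; linarith : (0 : ℝ) < _),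
    tendsto_nat_sqrt.eventually_gt_atTop 0, hcn.eventually_const_lt hc]
    with n h1 hqn hLn hn hr hbn hs hcn0 sp hsp
  set r := Nat.sqrt n with hrdef
  have hn' : (0 : ℝ) < n := by exact_mod_cast hn
  have hs' : (0 : ℝ) < r := by exact_mod_cast hs
  have hrn : (r : ℝ) * r ≤ n := by exact_mod_cast Nat.sqrt_le n
  have hr1 : (1 : ℝ) ≤ r := by exact_mod_cast hs
  have hfac : (0 : ℝ) < b.factorial := by exact_mod_cast b.factorial_pos
  -- the number of vertices left
  set N := n - (j + b * L n) - b * (K * n) / r with hN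
  have hNge : (1 - θ) * n ≤ (N : ℝ) := by
    have h2 : ((b * (K * n) / r : ℕ) : ℝ) ≤ (b * (K * n) : ℝ) / r := by
      have := @Nat.cast_div_le ℝ _ _ _ (b * (K * n)) r
      push_cast at this
      exact this
    have h3 : (n : ℝ) ≤ N + (j + b * L n) + ((b * (K * n) / r : ℕ) : ℝ) := by
      have : n ≤ N + (j + b * L n) + b * (K * n) / r := by omega
      exact_mod_cast this
    have h4 : ((j + b : ℝ) * (1 / (n : ℝ)) + (b * K : ℝ) * (1 / (r : ℝ))) * n ≤ (θ - θ₀) * n :=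
      mul_le_mul_of_nonneg_right hr.le hn'.le
    have h5 : ((j + b : ℝ) * (1 / (n : ℝ)) + (b * K : ℝ) * (1 / (r : ℝ))) * n =
        (j + b : ℝ) + (b * (K * n) : ℝ) / r := by
      field_simp
    rw [h5] at h4
    nlinarith
  have hNb : (1 - θ - b * (1 / (n : ℝ))) * n ≤ ((N + 1 - b : ℕ) : ℝ) := by
    have h2 : (1 - θ - b * (1 / (n : ℝ))) * n = (1 - θ) * n - b := by field_simp
    have h3 : (N : ℝ) + 1 ≤ ((N + 1 - b : ℕ) : ℝ) + b := by
      have : N + 1 ≤ (N + 1 - b) + b := by omega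
      exact_mod_cast this
    rw [h2]; linarith
  have hchoose : ((1 - θ - b * (1 / (n : ℝ))) * n) ^ b / b.factorial ≤ (N.choose b : ℝ) := by
    refine le_trans ?_ (Nat.pow_le_choose b N)
    have : 0 ≤ (1 - θ - b * (1 / (n : ℝ))) * n := by positivity
    gcongr
  -- the number of queries
  have hchoose' : (n.choose b : ℝ) ≤ (n : ℝ) ^ b / b.factorial := Nat.choose_le_pow_div b n
  have hnb : (0 : ℝ) < (n : ℝ) ^ b := by positivity
  have hone : 1 ≤ (n : ℝ) ^ b * (1 / (n : ℝ)) := by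
    obtain ⟨d, rfl⟩ := Nat.exists_eq_add_of_le' hb
    rw [pow_succ, mul_assoc, mul_one_div_cancel hn'.ne', mul_one]
    exact one_le_pow₀ (by exact_mod_cast hn)
  have hq' : (q n : ℝ) ≤ (n : ℝ) ^ b / b.factorial *
      ((1 + ε) / cn n + (b.factorial : ℝ) * (1 / (n : ℝ))) := by
    have h2 : (1 + ε) / cn n * (n.choose b : ℝ) ≤ (1 + ε) / cn n * ((n : ℝ) ^ b / b.factorial) := by
      have : 0 ≤ (1 + ε) / cn n := by positivity
      gcongr
    have h3 : (n : ℝ) ^ b / b.factorial * ((b.factorial : ℝ) * (1 / (n : ℝ))) =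
        (n : ℝ) ^ b * (1 / (n : ℝ)) := by
      field_simp
    rw [mul_add, h3]
    linarith
  have hsp' : (sp : ℝ) ≤ (n : ℝ) ^ b / b.factorial *
      (b.factorial * (A * (1 / (r : ℝ)) + (B * K + 1) * (1 / (n : ℝ)))) := by
    have h2 := spoiled_le hn hs (Nat.sqrt_le n) hsp
    rwa [← mul_assoc, div_mul_cancel₀ _ hfac.ne']
  have hfinal : (q n : ℝ) + sp ≤ (N.choose b : ℝ) := by
    refine le_trans (add_le_add hq' hsp') (le_trans ?_ hchoose)
    rw [← mul_add, mul_pow, div_mul_eq_mul_div]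
    refine div_le_div_of_nonneg_right ?_ hfac.le
    rw [mul_comm]
    exact mul_le_mul_of_nonneg_right h1.le hnb.le
  exact_mod_cast hfinal

/-! ### Choice of the constants -/

/-- Paths of length `(1 - δ / 3) * L₁` cover a proportion of at most `θ₀` of the vertices, and
`c * (1 - θ) ^ b > 1` for some `θ > θ₀`: the search is still supercritical. For large `δ` the number
`1 - δ / 3` is negative, hence the minimum with `1`. -/
lemma exists_proportion {b : ℕ} (hb : 1 ≤ b) {c δ : ℝ} (hc : 1 < c) (hδ : 0 < δ) :
    ∃ θ₀ θ : ℝ, 0 ≤ θ₀ ∧ θ₀ < θ ∧ θ < 1 ∧ 1 < c * (1 - θ) ^ b ∧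
      (1 - δ / 3) * (1 - c ^ (-1 / (b : ℝ))) ≤ θ₀ := by
  have hb0 : (0 : ℝ) < b := by exact_mod_cast hb
  have hc0 : 0 < c := by linarith
  set τ := c ^ (-1 / (b : ℝ)) with hτ
  have hτ0 : 0 < τ := Real.rpow_pos_of_pos hc0 _
  have hτ1 : τ < 1 := Real.rpow_lt_one_of_one_lt_of_neg hc (div_neg_of_neg_of_pos (by norm_num) hb0)
  have hτb : c * τ ^ b = 1 := by
    rw [hτ, ← Real.rpow_natCast, ← Real.rpow_mul hc0.le, div_mul_cancel₀ _ hb0.ne',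
      Real.rpow_neg_one, mul_inv_cancel₀ hc0.ne']
  set η := min (δ / 3) 1 with hη
  have hη0 : 0 < η := lt_min (by positivity) one_pos
  have hη1 : η ≤ 1 := min_le_right _ _
  have hηδ : η ≤ δ / 3 := min_le_left _ _
  have hτ1' : 0 < 1 - τ := by linarith
  refine ⟨(1 - η) * (1 - τ), (1 - η / 2) * (1 - τ), by nlinarith, by nlinarith, by nlinarith, ?_, ?_⟩
  · rw [← hτb]
    gcongr
    nlinarith
  · gcongr

/-- The numerical constants that make the potential grow with each edge found. -/
lemma exists_constants {C : ℕ} (hC : 1 ≤ C) {ε : ℝ} (hε : 0 < ε) :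
    ∃ (u g κ : ℝ) (s K : ℕ), 0 ≤ u ∧ u < 1 ∧ 1 < g ∧ g = 1 + (1 + ε) / C * u ∧ 0 ≤ κ ∧
      1 + κ ≤ (1 - u) * g ^ C ∧ g ^ 2 ≤ (1 + κ) ^ s ∧ g ^ (2 * (1 + C)) ≤ (1 + κ) ^ K := by
  have hC0 : (0 : ℝ) < C := by exact_mod_cast hC
  set u := ε / (2 * (1 + ε)) with hu
  have hu0 : 0 < u := by positivity
  have huε : (1 + ε) * u = ε / 2 := by rw [hu]; field_simp
  have hu1 : u < 1 := by nlinarith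
  set g := 1 + (1 + ε) / C * u with hg
  have hg1 : 1 < g := by
    have : 0 < (1 + ε) / C * u := by positivity
    linarith
  set κ := ε * u / 2 with hκ
  have hκ0 : 0 < κ := by positivity
  obtain ⟨s, hs⟩ := pow_unbounded_of_one_lt (g ^ 2) (by linarith : 1 < 1 + κ)
  obtain ⟨K, hK⟩ := pow_unbounded_of_one_lt (g ^ (2 * (1 + C))) (by linarith : 1 < 1 + κ)
  refine ⟨u, g, κ, s, K, hu0.le, hu1, hg1, rfl, hκ0.le, ?_, hs.le, hK.le⟩
  have h1 : 1 + (1 + ε) * u ≤ g ^ C := by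
    have := one_add_mul_le_pow (a := (1 + ε) / C * u)
      (by have : 0 < (1 + ε) / C * u := by positivity
          linarith) C
    refine le_trans (le_of_eq ?_) this
    field_simp
  calc 1 + κ = (1 - u) * (1 + (1 + ε) * u) := by
        rw [huε, hκ]
        have : u + ε * u = ε / 2 := by linarith
        linarith
    _ ≤ _ := by
        have : 0 ≤ 1 - u := by linarith
        gcongr

lemma exists_eq_add_mul {j b a : ℕ} (hj : 1 ≤ j) (hab : a ≤ b) (h : a ≡ j + b [MOD b]) :
    ∃ m, j = a + b * m := by
  have h' : a ≡ j [MOD b] := by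
    have : j + b ≡ j [MOD b] := by simp [Nat.ModEq]
    exact h.trans this
  rcases le_or_gt a j with haj | haj
  · obtain ⟨m, hm⟩ := (Nat.modEq_iff_dvd' haj).1 h'
    exact ⟨m, by omega⟩
  · obtain ⟨m, hm⟩ := (Nat.modEq_iff_dvd' haj.le).1 h'.symm
    rcases Nat.eq_zero_or_pos m with rfl | hm0
    · omega
    · have := Nat.le_mul_of_pos_right b hm0
      omega

theorem lemma3p1 (k j a : ℕ) (hj : 2 ≤ j) (hjk : j ≤ k - 1)
    (ha1 : 1 ≤ a) (ha2 : a ≤ k - j) (ha3 : a ≡ k [MOD (k - j)])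
    (δ : ℝ) (hδ : 0 < δ) (c : ℝ) (hc : 1 < c)
    (cn : ℕ → ℝ) (hcn : Tendsto cn atTop (𝓝 c))
    (p : ℕ → unitInterval)
    (hp : ∀ᶠ n in atTop, (p n : ℝ) = cn n * tightPathThreshold k j a n) :
    Tendsto
      (fun n : ℕ => (binomialHypergraph k n (p n)).real
        {H | (1 - δ / 3) * tightPathL₁ k j c n ≤ (longestTightPath k j H : ℝ)})
      atTop (𝓝 1) := by
  obtain ⟨b, rfl⟩ : ∃ b, k = j + b := ⟨k - j, by omega⟩
  have hb : 1 ≤ b := by omega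
  rw [Nat.add_sub_cancel_left] at ha2 ha3
  have hb0 : (0 : ℝ) < b := by exact_mod_cast hb
  have hm := exists_eq_add_mul (by omega) ha2 ha3
  obtain ⟨θ₀, θ, hθ0, hθ, hθ1, hcθ, hθδ⟩ := exists_proportion hb hc hδ
  obtain ⟨ε, hε, hcε⟩ : ∃ ε > 0, 1 + ε < c * (1 - θ) ^ b :=
    ⟨(c * (1 - θ) ^ b - 1) / 2, by linarith, by linarith⟩
  set C := b.choose a with hC
  have hC1 : 1 ≤ C := Nat.choose_pos ha2
  have hC0 : (0 : ℝ) < C := by exact_mod_cast hC1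
  obtain ⟨u, g, κ, s, K, hu0, hu1, hg1, hgeq, hκ, hκg, hgs, hgK⟩ := exists_constants hC1 hε
  let L : ℕ → ℕ := fun n => ⌈(1 - δ / 3) * tightPathL₁ (j + b) j c n⌉₊
  -- `q` queries lead to at least `q * p * C ≥ 1 + ε` new nodes on average
  let q : ℕ → ℕ := fun n => ⌈(1 + ε) / (p n * C)⌉₊
  let P : ℕ → SearchParams := fun n => ⟨j, b, a, s, Nat.sqrt n, q n⟩
  have hc0 : 0 < c := by linarith
  have hpn : ∀ᶠ n in atTop, 0 < (p n : ℝ) ∧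
      (1 + ε) / (p n * C) = (1 + ε) / cn n * (n.choose b : ℝ) := by
    filter_upwards [hp, hcn.eventually_const_lt hc0, eventually_ge_atTop b] with n h1 h2 h3
    have h4 : (0 : ℝ) < n.choose b := by exact_mod_cast Nat.choose_pos h3
    have h5 : (p n : ℝ) = cn n * (1 / (C * (n.choose b : ℝ))) := by
      rw [h1, tightPathThreshold, Nat.add_sub_cancel_left]
    rw [h5]
    refine ⟨by positivity, ?_⟩
    field_simp
  have hqn : ∀ᶠ n in atTop, (q n : ℝ) ≤ (1 + ε) / cn n * (n.choose b : ℝ) + 1 := by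
    filter_upwards [hpn] with n ⟨h1, h2⟩
    rw [← h2]
    exact (Nat.ceil_lt_add_one (by positivity)).le
  have hLn : ∀ n : ℕ, (b * L n : ℝ) ≤ θ₀ * n + b := by
    intro n
    have h1 : (1 - δ / 3) * tightPathL₁ (j + b) j c n ≤ θ₀ * n / b := by
      have e : ((j + b : ℕ) : ℝ) - (j : ℝ) = b := by push_cast; ring
      rw [tightPathL₁, e, le_div_iff₀ hb0]
      calc (1 - δ / 3) * ((1 - c ^ (-1 / (b : ℝ))) / b * n) * b
          = (1 - δ / 3) * (1 - c ^ (-1 / (b : ℝ))) * n := by field_simp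
        _ ≤ θ₀ * n := by gcongr
    have h2 : (L n : ℝ) ≤ θ₀ * n / b + 1 :=
      (Nat.cast_le.2 (Nat.ceil_mono h1)).trans (Nat.ceil_lt_add_one (by positivity)).le
    calc (b * L n : ℝ) ≤ b * (θ₀ * n / b + 1) := by gcongr
      _ = θ₀ * n + b := by field_simp
  have hroom := eventually_room (j := j) (A := 1 + (j + (1 + j * C) * s) * C) (B := C) (K := K)
    hb hc0 hε hθ hθ1 hcε hcn hqn (Eventually.of_forall hLn)
  -- the probability of failure is at most `1 / g ^ √n`
  have hbad : ∀ᶠ n in atTop, 1 - (1 / g) ^ Nat.sqrt n ≤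
      (binomialHypergraph (j + b) n (p n)).real
        {H | (1 - δ / 3) * tightPathL₁ (j + b) j c n ≤ (longestTightPath (j + b) j H : ℝ)} := by
    have hsmall : ∀ᶠ n in atTop, Nat.sqrt n + j ≤ n := by
      filter_upwards [eventually_ge_atTop ((j + 2) ^ 2)] with n hn
      have h1 : j + 2 ≤ Nat.sqrt n := Nat.le_sqrt.2 (by nlinarith)
      have h2 := Nat.sqrt_le n
      nlinarith
    have hLle : ∀ᶠ n in atTop, L n ≤ n := by
      have h0 : Tendsto (fun n : ℕ => (1 - θ₀) * (n : ℝ)) atTop atTop :=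
        Tendsto.const_mul_atTop (by linarith) tendsto_natCast_atTop_atTop
      filter_upwards [h0.eventually_ge_atTop (b : ℝ)] with n hn
      have h1 : (b * L n : ℝ) ≤ n := by linarith [hLn n]
      have h2 : (L n : ℝ) ≤ b * L n := le_mul_of_one_le_left (by positivity) (by exact_mod_cast hb)
      exact_mod_cast h2.trans h1
    filter_upwards [hroom, hsmall, hLle, hpn, eventually_gt_atTop 0] with n hr hsm hLe ⟨hp0, hpe⟩ hn0
    obtain ⟨roots, hRc, hRl, hRn, hRi⟩ := exists_roots (by omega) hsm
    have hgq : g ≤ 1 + (P n).q * (p n * u) := by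
      have h1 : (1 + ε) / (p n * C) ≤ (q n : ℝ) := Nat.le_ceil _
      have h2 : (1 + ε) / C ≤ q n * p n := by
        rw [div_le_iff₀ (by positivity)] at h1 ⊢
        linarith
      rw [hgeq, ← mul_assoc]
      gcongr
    have hX : g ^ (2 * (roots.card + C * L n)) ≤ (1 + κ) ^ (K * n) := by
      rw [hRc, pow_mul (1 + κ)]
      calc g ^ (2 * (Nat.sqrt n + C * L n)) ≤ g ^ (2 * (1 + C) * n) := by
            refine pow_le_pow_right₀ hg1.le ?_
            have h1 := Nat.sqrt_le_self n
            have h2 : C * L n ≤ C * n := Nat.mul_le_mul_left _ hLe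
            linarith
        _ = (g ^ (2 * (1 + C))) ^ n := pow_mul _ _ _
        _ ≤ _ := by gcongr
    have hgood : (P n).Good := ⟨hj, ha1, ha2, hm⟩
    have hfail := SearchState.measure_noPath_mul_le_one (P := P n) hgood (p n)
      hRl hRn hRi (L := L n) (Xmax := K * n) hu0 hu1 hg1.le hgq hκ hκg hgs hX
      (Nat.sqrt_pos.2 hn0) (by
        intro sp hsp
        rw [Fintype.card_fin] at hsp ⊢
        refine hr sp (hsp.trans (le_of_eq ?_))
        simp only [SearchState.nearBound, hRc, P, ← hC]
        ring)
    have hgpos : 0 < g ^ Nat.sqrt n := by positivity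
    rw [hRc, ← le_div_iff₀ hgpos, ← one_div_pow] at hfail
    have hcompl := probReal_add_probReal_compl
      (μ := setBernoulli {e : Finset (Fin n) | e.card = j + b} (p n))
      (s := {H | ∀ ℓ ≥ L n, ¬ HasTightPath (j + b) j H ℓ}) MeasurableSet.of_discrete
    have hmono : (setBernoulli {e : Finset (Fin n) | e.card = j + b} (p n)).real
        {H | ∀ ℓ ≥ L n, ¬ HasTightPath (j + b) j H ℓ}ᶜ ≤
        (binomialHypergraph (j + b) n (p n)).real
        {H | (1 - δ / 3) * tightPathL₁ (j + b) j c n ≤ (longestTightPath (j + b) j H : ℝ)} := by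
      refine measureReal_mono ?_
      intro H hH
      simp only [Set.mem_compl_iff, Set.mem_ofPred_eq] at hH ⊢
      push Not at hH
      obtain ⟨ℓ, hℓ, hpath⟩ := hH
      have h1 : ℓ ≤ longestTightPath (j + b) j H :=
        le_csSup (bddAbove_hasTightPath (by omega) H) hpath
      exact (Nat.le_ceil _).trans (by exact_mod_cast hℓ.trans h1)
    have hfail' : (setBernoulli {e : Finset (Fin n) | e.card = j + b} (p n)).real
        {H | ∀ ℓ ≥ L n, ¬ HasTightPath (j + b) j H ℓ} ≤ (1 / g) ^ Nat.sqrt n := hfail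
    linarith
  have hlim : Tendsto (fun n : ℕ => 1 - (1 / g) ^ Nat.sqrt n) atTop (𝓝 1) := by
    have h1 : Tendsto (fun n : ℕ => (1 / g) ^ Nat.sqrt n) atTop (𝓝 0) :=
      (tendsto_pow_atTop_nhds_zero_of_lt_one (by positivity)
        ((div_lt_one (by linarith)).2 hg1)).comp tendsto_nat_sqrt
    simpa using tendsto_const_nhds.sub h1
  refine tendsto_of_tendsto_of_tendsto_of_le_of_le' hlim tendsto_const_nhds hbad ?_
  refine Eventually.of_forall fun n => ?_
  have : IsProbabilityMeasure (binomialHypergraph (j + b) n (p n)) := by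
    unfold binomialHypergraph; infer_instance
  exact measureReal_le_one
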